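/- Let $\mathbb{B}^d=\{z\in\mathbb{C}^d : |z|<1\}$ be the open Euclidean unit ball. For $\sigma>d$ let $\mu_\sigma$ be the measure on $\mathbb{B}^d$ given by $$d\mu_\sigma(z)=c_\sigma(1-|z|^2)^{\sigma}\,d\tau(z),\qquad d\tau(z)=(1-|z|^2)^{-(d+1)}\,dz,\qquad c_\sigma=\frac{\Gamma(\sigma)}{\pi^d\,\Gamma(\sigma-d)},$$ where $dz$ is $2d$-dimensional Lebesgue measure. Let $\mathcal{H}L^2(\mathbb{B}^d,\mu_\sigma)$ be the space of holomorphic functions on $\mathbb{B}^d$ that are square-integrable with respect to $\mu_\sigma$, with the inner product $\langle F,G\rangle_{\mathcal{H}L^2(\mathbb{B}^d,\mu_\sigma)}=\int_{\mathbb{B}^d}\overline{F}\,G\,d\mu_\sigma$. Let $N=\sum_{j=1}^d z_j\,\partial/\partial z_j$. **Theorem.** Let $\lambda>0$ be real and let $n$ be a non-negative integer with $\lambda+2n>d$. Define $$H(\mathbb{B}^d,\lambda)=\{f \text{ holomorphic on } \mathbb{B}^d : N^kf\in\mathcal{H}L^2(\mathbb{B}^d,\mu_{\lambda+2n})\text{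 for } 0\le k\le n\}$$ and the operators $$A=\prod_{j=0}^{n-1}\Bigl(I+\frac{N}{\lambda+n+j}\Bigr),\qquad B=\prod_{j=0}^{n-1}\Bigl(I+\frac{N}{\lambda+j}\Bigr).$$ Then: 1. For $f\in H(\mathbb{B}^d,\lambda)$ the functions $Af$ and $Bf$ belong to $\mathcal{H}L^2(\mathbb{B}^d,\mu_{\lambda+2n})$, the formula $$\langle f,g\rangle_\lambda=\langle Af,Bg\rangle_{\mathcal{H}L^2(\mathbb{B}^d,\mu_{\lambda+2n})}$$ defines an inner product on $H(\mathbb{B}^d,\lambda)$, and $H(\mathbb{B}^d,\lambda)$ is complete with respect to it. 2. The monomials $z^m$, where $m$ ranges over all multi-indices in $\mathbb{N}^d$, belong to $H(\mathbb{B}^d,\lambda)$ and form an orthogonal basis of it (they are pairwise orthogonal and nonzero, and their linear span is dense), and for all multi-indices $l$ and $m$ $$\langle z^l,z^m\rangle_\lambda=\delta_{l,m}\,\frac{m!\,\Gamma(\lambda)}{\Gamma(\lambda+|m|)},$$ where $m!=\prod_j m_j!$ and $|m|=\sum_j m_j$. 3. $H(\mathbb{B}^d,\lambda)$ has the reproducing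 kernel $$K_\lambda(z,w)=\frac{1}{(1-z\cdot\bar w)^{\lambda}},\qquad z\cdot\bar w=\sum_j z_j\bar w_j,$$ (principal branch of the power); that is, for every $z\in\mathbb{B}^d$ the function $w\mapsto\overline{K_\lambda(z,w)}$ belongs to $H(\mathbb{B}^d,\lambda)$, and $\langle \overline{K_\lambda(z,\cdot)},f\rangle_\lambda=f(z)$ for all $f\in H(\mathbb{B}^d,\lambda)$. -/

import Mathlib

open MeasureTheory ComplexConjugate

noncomputable section

/-- `|z|² = ∑ⱼ |zⱼ|²`, the square of the Euclidean norm on `ℂᵈ`. (The type `Fin d → ℂ` carries the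
sup norm, so the Euclidean norm is written out; the topology and the notion of
complex differentiability do not depend on the norm.) -/
def sqNorm {d : ℕ} (z : Fin d → ℂ) : ℝ := ∑ j, ‖z j‖ ^ 2

/-- The open Euclidean unit ball of `ℂᵈ`. -/
def unitBall (d : ℕ) : Set (Fin d → ℂ) := {z | sqNorm z < 1}

/-- Extension by `0` of a function on the ball to all of `ℂᵈ`. It is only used to speak of
derivatives at points of the (open) ball. -/
def extendZero {d : ℕ} (f : unitBall d → ℂ) : (Fin d → ℂ) → ℂ :=
  Function.extend Subtype.val f 0

/-- `f` is holomorphic on the unit ball. -/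
def Holomorphic {d : ℕ} (f : unitBall d → ℂ) : Prop :=
  DifferentiableOn ℂ (extendZero f) (unitBall d)

/-- The hyperbolic volume measure `dτ(z) = (1 - |z|²)^{-(d+1)} dz` on the ball, where `dz` is
`2d`-dimensional Lebesgue measure. -/
def hyperbolicMeasure (d : ℕ) : Measure (unitBall d) :=
  ((volume : Measure (Fin d → ℂ)).comap (Subtype.val : unitBall d → Fin d → ℂ)).withDensity
    fun z => ENNReal.ofReal ((1 - sqNorm (z : Fin d → ℂ)) ^ (-((d : ℝ) + 1)))

/-- `c_σ = Γ(σ) / (π^d Γ(σ - d))`, for `σ > d`. -/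
def normConst (d : ℕ) (σ : ℝ) : ℝ := Real.Gamma σ / (Real.pi ^ d * Real.Gamma (σ - d))

/-- `dμ_σ(z) = c_σ (1 - |z|²)^σ dτ(z)`, for `σ > d`. -/
def bergmanMeasure (d : ℕ) (σ : ℝ) : Measure (unitBall d) :=
  (hyperbolicMeasure d).withDensity
    fun z => ENNReal.ofReal (normConst d σ * (1 - sqNorm (z : Fin d → ℂ)) ^ σ)

/-- Membership in the Bergman space `HL²(𝔹ᵈ, μ_σ)` of holomorphic functions that are
square-integrable with respect to `μ_σ`. -/
def MemBergman {d : ℕ} (σ : ℝ) (f : unitBall d → ℂ) : Prop :=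
  Holomorphic f ∧ MemLp f 2 (bergmanMeasure d σ)

/-- The inner product of `HL²(𝔹ᵈ, μ_σ)`, conjugate-linear in the first variable. -/
def bergmanInner {d : ℕ} (σ : ℝ) (f g : unitBall d → ℂ) : ℂ :=
  ∫ z, conj (f z) * g z ∂(bergmanMeasure d σ)

/-- The number operator `N = ∑ⱼ zⱼ ∂/∂zⱼ`. -/
def numberOp {d : ℕ} (f : unitBall d → ℂ) : unitBall d → ℂ := fun z =>
  ∑ j, (z : Fin d → ℂ) j * fderiv ℂ (extendZero f) (z : Fin d → ℂ) (Pi.single j 1)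

/-- The operator `I + N / a`. -/
def shiftOp {d : ℕ} (a : ℝ) (f : unitBall d → ℂ) : unitBall d → ℂ := fun z =>
  f z + numberOp f z / (a : ℂ)

/-- The operator `(I + N / a) (I + N / (a + 1)) ⋯ (I + N / (a + k - 1))`. -/
def shiftProd {d : ℕ} (a : ℝ) : ℕ → (unitBall d → ℂ) → (unitBall d → ℂ)
  | 0, f => f
  | k + 1, f => shiftProd a k (shiftOp (a + k) f)

/-- The operator `A = (I + N / (lam + n)) ⋯ (I + N / (lam + 2n - 1))`. -/
def opA {d : ℕ} (lam : ℝ) (n : ℕ) (f : unitBall d → ℂ) : unitBall d → ℂ :=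
  shiftProd (lam + n) n f

/-- The operator `B = (I + N / lam) ⋯ (I + N / (lam + n - 1))`. -/
def opB {d : ℕ} (lam : ℝ) (n : ℕ) (f : unitBall d → ℂ) : unitBall d → ℂ :=
  shiftProd lam n f

/-- The monomial `z^m`, as a function on the ball. -/
def monomialFun {d : ℕ} (m : Fin d → ℕ) : unitBall d → ℂ := fun z =>
  ∏ j, (z : Fin d → ℂ) j ^ m j

/-- `K_lam(z, w) = (1 - z · w̄)^{-lam}`. The real part of `1 - z · w̄` is positive on the ball, and
the power is the principal one. -/
def bergmanKernel {d : ℕ} (lam : ℝ) (z w : unitBall d) : ℂ :=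
  1 / (1 - ∑ j, (z : Fin d → ℂ) j * conj ((w : Fin d → ℂ) j)) ^ (lam : ℂ)

theorem isOpen_unitBall (d : ℕ) : IsOpen (unitBall d) := by
  have : Continuous (sqNorm : (Fin d → ℂ) → ℝ) := by
    unfold sqNorm; fun_prop
  exact isOpen_lt this continuous_const

theorem extendZero_add {d : ℕ} (f g : unitBall d → ℂ) :
    extendZero (f + g) = extendZero f + extendZero g := by
  have := Function.extend_add (Subtype.val : unitBall d → Fin d → ℂ) f g 0 0
  simpa [extendZero] using this

theorem extendZero_smul {d : ℕ} (c : ℂ) (f : unitBall d → ℂ) :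
    extendZero (c • f) = c • extendZero f := by
  have := Function.extend_smul c (Subtype.val : unitBall d → Fin d → ℂ) f 0
  simpa [extendZero] using this

theorem Holomorphic.differentiableAt {d : ℕ} {f : unitBall d → ℂ} (hf : Holomorphic f)
    (z : unitBall d) : DifferentiableAt ℂ (extendZero f) (z : Fin d → ℂ) :=
  DifferentiableOn.differentiableAt hf ((isOpen_unitBall d).mem_nhds z.2)

theorem Holomorphic.add {d : ℕ} {f g : unitBall d → ℂ} (hf : Holomorphic f)
    (hg : Holomorphic g) : Holomorphic (f + g) := by
  unfold Holomorphic
  rw [extendZero_add]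
  exact DifferentiableOn.add hf hg

theorem Holomorphic.smul {d : ℕ} (c : ℂ) {f : unitBall d → ℂ} (hf : Holomorphic f) :
    Holomorphic (c • f) := by
  unfold Holomorphic
  rw [extendZero_smul]
  exact DifferentiableOn.const_smul hf c

theorem numberOp_add {d : ℕ} {f g : unitBall d → ℂ} (hf : Holomorphic f)
    (hg : Holomorphic g) : numberOp (f + g) = numberOp f + numberOp g := by
  funext z
  simp only [numberOp, extendZero_add, Pi.add_apply]
  rw [fderiv_add (hf.differentiableAt z) (hg.differentiableAt z)]
  simp [mul_add, Finset.sum_add_distrib]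

theorem numberOp_smul {d : ℕ} (c : ℂ) {f : unitBall d → ℂ} (hf : Holomorphic f) :
    numberOp (c • f) = c • numberOp f := by
  funext z
  simp only [numberOp, extendZero_smul, Pi.smul_apply]
  rw [fderiv_const_smul (hf.differentiableAt z)]
  simp [Finset.mul_sum, mul_left_comm]

theorem numberOp_iterate_add {d n : ℕ} {f g : unitBall d → ℂ}
    (hf : ∀ k ≤ n, Holomorphic (numberOp^[k] f)) (hg : ∀ k ≤ n, Holomorphic (numberOp^[k] g))
    (k : ℕ) (hk : k ≤ n) : numberOp^[k] (f + g) = numberOp^[k] f + numberOp^[k] g := by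
  induction k with
  | zero => rfl
  | succ k ih =>
    simp only [Function.iterate_succ_apply']
    rw [ih (by omega), numberOp_add (hf k (by omega)) (hg k (by omega))]

theorem numberOp_iterate_smul {d n : ℕ} (c : ℂ) {f : unitBall d → ℂ}
    (hf : ∀ k ≤ n, Holomorphic (numberOp^[k] f))
    (k : ℕ) (hk : k ≤ n) : numberOp^[k] (c • f) = c • numberOp^[k] f := by
  induction k with
  | zero => rfl
  | succ k ih =>
    simp only [Function.iterate_succ_apply']
    rw [ih (by omega), numberOp_smul c (hf k (by omega))]

theorem extendZero_zero {d : ℕ} : extendZero (0 : unitBall d → ℂ) = 0 := by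
  simpa using extendZero_smul (0 : ℂ) (0 : unitBall d → ℂ)

theorem Holomorphic.zero {d : ℕ} : Holomorphic (0 : unitBall d → ℂ) := by
  unfold Holomorphic
  rw [extendZero_zero]
  exact differentiableOn_const 0

theorem numberOp_iterate_zero {d : ℕ} (k : ℕ) : numberOp^[k] (0 : unitBall d → ℂ) = 0 := by
  induction k with
  | zero => rfl
  | succ k ih =>
    rw [Function.iterate_succ_apply', ih]
    simpa using numberOp_smul (0 : ℂ) (Holomorphic.zero (d := d))

/-- The linear space of holomorphic `f` on the ball such that `N^k f ∈ HL²(𝔹ᵈ, μ_{lam + 2n})` for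
`0 ≤ k ≤ n`. -/
def genBergmanSubmodule (d : ℕ) (lam : ℝ) (n : ℕ) : Submodule ℂ (unitBall d → ℂ) where
  carrier := {f | Holomorphic f ∧ ∀ k ≤ n, MemBergman (lam + 2 * n) (numberOp^[k] f)}
  zero_mem' := by
    refine ⟨Holomorphic.zero, fun k _ => ?_⟩
    rw [numberOp_iterate_zero]
    exact ⟨Holomorphic.zero, MemLp.zero⟩
  add_mem' := by
    rintro f g ⟨hf, hf'⟩ ⟨hg, hg'⟩
    refine ⟨hf.add hg, fun k hk => ?_⟩
    rw [numberOp_iterate_add (fun j hj => (hf' j hj).1) (fun j hj => (hg' j hj).1) k hk]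
    exact ⟨(hf' k hk).1.add (hg' k hk).1, (hf' k hk).2.add (hg' k hk).2⟩
  smul_mem' := by
    rintro c f ⟨hf, hf'⟩
    refine ⟨hf.smul c, fun k hk => ?_⟩
    rw [numberOp_iterate_smul c (fun j hj => (hf' j hj).1) k hk]
    exact ⟨(hf' k hk).1.smul c, (hf' k hk).2.const_smul c⟩

/-- The space `H(𝔹ᵈ, lam)` built with the parameter `n`. It is a separate type, so that it carries
no topology from the space of all functions: its only topology is the one of an inner product. -/
def GenBergman (d : ℕ) (lam : ℝ) (n : ℕ) : Type := genBergmanSubmodule d lam n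

instance (d : ℕ) (lam : ℝ) (n : ℕ) : AddCommGroup (GenBergman d lam n) :=
  inferInstanceAs (AddCommGroup (genBergmanSubmodule d lam n))

instance (d : ℕ) (lam : ℝ) (n : ℕ) : Module ℂ (GenBergman d lam n) :=
  inferInstanceAs (Module ℂ (genBergmanSubmodule d lam n))

/-- The function on the ball underlying an element of `H(𝔹ᵈ, lam)`. -/
def GenBergman.toFun {d : ℕ} {lam : ℝ} {n : ℕ} (f : GenBergman d lam n) : unitBall d → ℂ :=
  f.1

end

/-! Everything is diagonal in the monomials. Rotation invariance of `μ_σ` makes them orthogonal, and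
Beta integrals give `‖z^m‖² = w_σ(m) = m! Γ(σ) / Γ(σ + |m|)` (`lintegral_enorm_monomialFun_sq`).
Since `N z^m = |m| z^m`, for `σ = λ + 2n` the operators `A` and `B` together contribute the factor
`∏_{j < 2n} (1 + |m| / (λ + j))`, a telescoping Gamma quotient that turns `w_{λ+2n}(m)` into
`w_λ(m)` (`shiftFactor_mul_monomialWeight`). This factor is comparable to `(1 + |m|)^{2n}`, so
`H(𝔹ᵈ, λ)` consists exactly of the power series with `∑ |a_m|² w_λ(m) < ∞`. It is a copy of `ℓ²`,
from which completeness and the orthogonal basis are inherited. The kernel is `∑ z^m w̄^m / w_λ(m)`,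
summed by the multinomial theorem and the binomial series.

The analytic work lies in passing from functions to coefficients. A holomorphic function is first
written only as a series of homogeneous polynomials (`Holomorphic.exists_hasHomogeneousExpansion`).
Parseval on circles then gives `‖f‖² = ∑ |a_m|² w_σ(m)` in `[0, ∞]`
(`HasHomogeneousExpansion.lintegral_enorm_sq`). If this is finite, comparison with the kernel on the
diagonal makes the full power series converge absolutely, and it may be differentiated term by term
(`HasMonomialExpansion.hasFDerivAt`). -/

/-! ### Beta integrals over the ball -/

/-- `t ↦ t^(s-1)` on the positive half line, extended by `0`. -/
noncomputable def posPow (s t : ℝ) : ENNReal := if 0 < t then ENNReal.ofReal (t ^ (s - 1)) else 0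

theorem measurable_posPow (s : ℝ) : Measurable (posPow s) :=
  Measurable.ite measurableSet_Ioi (by fun_prop) measurable_const

/-- Polar coordinates and `t = r²`: the angle gives `2π` and `r dr = dt / 2`. -/
theorem Complex.lintegral_comp_norm_sq {g : ℝ → ENNReal} (hg : Measurable g) :
    ∫⁻ z : ℂ, g (‖z‖ ^ 2) = ENNReal.ofReal Real.pi * ∫⁻ t in Set.Ioi (0 : ℝ), g t := by
  have himg : (fun r : ℝ => r ^ 2) '' Set.Ioi 0 = Set.Ioi 0 := by
    ext t
    simp only [Set.mem_image, Set.mem_Ioi]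
    exact ⟨fun ⟨r, hr, h⟩ => h ▸ by positivity,
      fun ht => ⟨√t, Real.sqrt_pos.2 ht, Real.sq_sqrt ht.le⟩⟩
  have hsub := lintegral_image_eq_lintegral_abs_deriv_mul (s := Set.Ioi (0 : ℝ))
    (f := fun r => r ^ 2) (f' := fun r => 2 * r) measurableSet_Ioi
    (fun x _ => by simpa using (hasDerivAt_pow 2 x).hasDerivWithinAt)
    (fun x hx y hy h => by
      simpa using (pow_left_inj₀ (le_of_lt hx) (le_of_lt hy) two_ne_zero).1 h) g
  rw [himg] at hsub
  rw [← Complex.lintegral_comp_polarCoord_symm, hsub, polarCoord_target,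
    Measure.volume_eq_prod, ← Measure.prod_restrict, lintegral_prod _ (by
      simp only [Complex.norm_polarCoord_symm]
      fun_prop)]
  simp only [Complex.norm_polarCoord_symm, sq_abs, lintegral_const, Measure.restrict_apply,
    MeasurableSet.univ, Set.univ_inter, Real.volume_Ioo, smul_eq_mul]
  rw [← lintegral_const_mul _ (by fun_prop)]
  refine setLIntegral_congr_fun measurableSet_Ioi fun r (hr : 0 < r) => ?_
  rw [abs_of_pos (by positivity), ENNReal.ofReal_mul zero_le_two,
    show Real.pi - -Real.pi = 2 * Real.pi by ring, ENNReal.ofReal_mul zero_le_two]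
  ring

/-- The substitution `t = ρ x` produces the Beta density, whose total mass is one. The cut-off in
`posPow` makes both sides vanish for `ρ ≤ 0`, so no condition on `ρ` has to be carried through the
iterated integral. -/
theorem lintegral_pow_mul_posPow (k : ℕ) {s : ℝ} (hs : 0 < s) (ρ : ℝ) :
    ∫⁻ t in Set.Ioi (0 : ℝ), ENNReal.ofReal (t ^ k) * posPow s (ρ - t) =
      ENNReal.ofReal (ProbabilityTheory.beta (k + 1) s) * posPow (s + k + 1) ρ := by
  rcases le_or_gt ρ 0 with hρ | hρ
  · rw [posPow, if_neg hρ.not_gt, mul_zero, setLIntegral_congr_fun (g := 0) measurableSet_Ioi]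
    · simp
    · intro t (ht : 0 < t)
      simp [posPow, show ¬ 0 < ρ - t by linarith]
  have himg : (fun x : ℝ => ρ * x) '' Set.Ioi 0 = Set.Ioi 0 := by
    ext t
    simp only [Set.mem_image, Set.mem_Ioi]
    exact ⟨fun ⟨r, hr, h⟩ => h ▸ by positivity, fun ht => ⟨t / ρ, by positivity, by field_simp⟩⟩
  have hsub := lintegral_image_eq_lintegral_abs_deriv_mul (s := Set.Ioi (0 : ℝ))
    (f := fun x => ρ * x) (f' := fun _ => ρ) measurableSet_Ioi
    (fun x _ => by simpa using ((hasDerivAt_id x).const_mul ρ).hasDerivWithinAt)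
    (fun x _ y _ h => by simpa [hρ.ne'] using h)
    (fun t => ENNReal.ofReal (t ^ k) * posPow s (ρ - t))
  have hb : 0 < ProbabilityTheory.beta (k + 1) s := ProbabilityTheory.beta_pos (by positivity) hs
  have hpdf : ∫⁻ x in Set.Ioi (0 : ℝ), ProbabilityTheory.betaPDF (k + 1) s x = 1 := by
    rw [← ProbabilityTheory.lintegral_betaPDF_eq_one (α := k + 1) (β := s) (by positivity) hs]
    refine setLIntegral_eq_of_support_subset fun x hx => ?_
    by_contra h
    exact hx (ProbabilityTheory.betaPDF_eq_zero_of_nonpos (not_lt.1 h))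
  rw [himg] at hsub
  rw [hsub, ← mul_one (ENNReal.ofReal _ * _), ← hpdf, ← lintegral_const_mul' _ _ (by
    rw [posPow, if_pos hρ]
    exact ENNReal.mul_ne_top ENNReal.ofReal_ne_top ENNReal.ofReal_ne_top)]
  refine setLIntegral_congr_fun measurableSet_Ioi fun x (hx : 0 < x) => ?_
  rcases le_or_gt 1 x with h1 | h1
  · have : ¬ 0 < ρ - ρ * x := by nlinarith
    simp [posPow, this, ProbabilityTheory.betaPDF_eq_zero_of_one_le h1]
  · have h2 : 0 < 1 - x := by linarith
    have h3 : ρ - ρ * x = ρ * (1 - x) := by ring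
    simp only [h3]
    rw [posPow, if_pos (by positivity), posPow, if_pos hρ,
      ProbabilityTheory.betaPDF_of_pos_lt_one hx h1, abs_of_pos hρ,
      ← ENNReal.ofReal_mul (by positivity), ← ENNReal.ofReal_mul (by positivity),
      ← ENNReal.ofReal_mul (by positivity), ← ENNReal.ofReal_mul (by positivity)]
    congr 1
    rw [Real.mul_rpow hρ.le h2.le, mul_pow, show s + k + 1 - 1 = (s - 1) + (k : ℝ) + 1 by ring,
      Real.rpow_add hρ, Real.rpow_add hρ, Real.rpow_one, Real.rpow_natCast, add_sub_cancel_right,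
      Real.rpow_natCast]
    field_simp

theorem measurable_sqNorm {d : ℕ} : Measurable (sqNorm : (Fin d → ℂ) → ℝ) := by
  unfold sqNorm; fun_prop

/-- Integrating out the first coordinate leaves the same integral in one dimension less, with `s`
raised to `s + m 0 + 1`; hence the induction over all `s`. The Beta factors telescope into one Gamma
quotient. -/
theorem lintegral_monomial_mul_posPow (d : ℕ) (m : Fin d → ℕ) {s : ℝ} (hs : 0 < s) :
    ∫⁻ z : Fin d → ℂ, ENNReal.ofReal (∏ j, (‖z j‖ ^ 2) ^ m j) * posPow s (1 - sqNorm z) =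
      ENNReal.ofReal (Real.pi ^ d * ((∏ j, ((m j).factorial : ℝ)) * Real.Gamma s /
        Real.Gamma (s + d + ∑ j, (m j : ℝ)))) := by
  induction d generalizing s with
  | zero =>
    have := (Real.Gamma_pos_of_pos hs).ne'
    simp [posPow, sqNorm, this, volume_pi]
  | succ d ih =>
    have hmp := (volume_preserving_piFinSuccAbove (fun _ : Fin (d + 1) => ℂ) 0).symm
    have hmeas (k : ℕ) (s : ℝ) (m : Fin k → ℕ) : Measurable fun z : Fin k → ℂ =>
        ENNReal.ofReal (∏ j, (‖z j‖ ^ 2) ^ m j) * posPow s (1 - sqNorm z) :=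
      (by fun_prop : Measurable fun z : Fin k → ℂ =>
        ENNReal.ofReal (∏ j, (‖z j‖ ^ 2) ^ m j)).mul
        ((measurable_posPow s).comp (measurable_const.sub measurable_sqNorm))
    have hs1 : 0 < s + m 0 + 1 := by positivity
    have hb := ProbabilityTheory.beta_pos (α := m 0 + 1) (by positivity) hs
    rw [← hmp.lintegral_comp (hmeas _ _ _), Measure.volume_eq_prod]
    refine (lintegral_prod_symm _ ((hmeas _ s m).comp hmp.measurable).aemeasurable).trans ?_
    have key (y : Fin d → ℂ) : ∫⁻ x : ℂ, ENNReal.ofReal (∏ j, (‖(MeasurableEquiv.piFinSuccAbove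
          (fun _ : Fin (d + 1) => ℂ) 0).symm (x, y) j‖ ^ 2) ^ m j) *
          posPow s (1 - sqNorm ((MeasurableEquiv.piFinSuccAbove
          (fun _ : Fin (d + 1) => ℂ) 0).symm (x, y))) =
        ENNReal.ofReal (Real.pi * ProbabilityTheory.beta (m 0 + 1) s) *
          (ENNReal.ofReal (∏ j, (‖y j‖ ^ 2) ^ m j.succ) *
            posPow (s + m 0 + 1) (1 - sqNorm y)) := by
      have h1 (x : ℂ) : ENNReal.ofReal (∏ j, (‖(MeasurableEquiv.piFinSuccAbove
          (fun _ : Fin (d + 1) => ℂ) 0).symm (x, y) j‖ ^ 2) ^ m j) *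
          posPow s (1 - sqNorm ((MeasurableEquiv.piFinSuccAbove
          (fun _ : Fin (d + 1) => ℂ) 0).symm (x, y))) =
          ENNReal.ofReal (∏ j, (‖y j‖ ^ 2) ^ m j.succ) * (fun t => ENNReal.ofReal (t ^ m 0) *
            posPow s ((1 - sqNorm y) - t)) (‖x‖ ^ 2) := by
        simp only [MeasurableEquiv.piFinSuccAbove_symm_apply, Fin.insertNthEquiv_zero,
          Fin.consEquiv_apply, Fin.prod_univ_succ, Fin.cons_zero, Fin.cons_succ, sqNorm,
          Fin.sum_univ_succ]
        rw [ENNReal.ofReal_mul (by positivity), sub_add_eq_sub_sub_swap]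
        ring
      have h2 : Measurable fun t => ENNReal.ofReal (t ^ m 0) * posPow s ((1 - sqNorm y) - t) :=
        (by fun_prop : Measurable fun t : ℝ => ENNReal.ofReal (t ^ m 0)).mul
          ((measurable_posPow s).comp (by fun_prop))
      refine (lintegral_congr h1).trans
        ((lintegral_const_mul _ (h2.comp (by fun_prop : Measurable fun x : ℂ => ‖x‖ ^ 2))).trans ?_)
      simp only [Function.comp_def]
      rw [Complex.lintegral_comp_norm_sq h2, lintegral_pow_mul_posPow _ hs, ENNReal.ofReal_mul Real.pi_nonneg]
      ring
    refine (lintegral_congr key).trans ?_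
    rw [lintegral_const_mul _ (hmeas _ _ _), ih (fun j => m j.succ) hs1,
      ← ENNReal.ofReal_mul (by positivity)]
    congr 1
    have hG1 := (Real.Gamma_pos_of_pos hs1).ne'
    rw [ProbabilityTheory.beta, show (m 0 : ℝ) + 1 + s = s + m 0 + 1 by ring,
      Fin.prod_univ_succ, Fin.sum_univ_succ, Real.Gamma_nat_eq_factorial, pow_succ,
      show s + ((d + 1 : ℕ) : ℝ) + (m 0 + ∑ i : Fin d, (m i.succ : ℝ)) =
        s + m 0 + 1 + d + ∑ i : Fin d, (m i.succ : ℝ) by push_cast; ring]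
    field_simp

/-! ### Norms of monomials in the Bergman space -/

/-- The squared norm `m! Γ(s) / Γ(s + |m|)` of the monomial `z^m`. -/
noncomputable def monomialWeight {d : ℕ} (s : ℝ) (m : Fin d → ℕ) : ℝ :=
  (∏ j, ((m j).factorial : ℝ)) * Real.Gamma s / Real.Gamma (s + ∑ j, (m j : ℝ))

theorem monomialWeight_pos {d : ℕ} {s : ℝ} (hs : 0 < s) (m : Fin d → ℕ) :
    0 < monomialWeight s m := by
  unfold monomialWeight
  have := Real.Gamma_pos_of_pos hs
  have h2 : 0 < Real.Gamma (s + ∑ j, (m j : ℝ)) := Real.Gamma_pos_of_pos (by positivity)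
  positivity

theorem measurable_sqNorm_coe {d : ℕ} : Measurable fun z : unitBall d => sqNorm (z : Fin d → ℂ) :=
  measurable_sqNorm.comp measurable_subtype_coe

theorem normConst_pos {d : ℕ} {σ : ℝ} (hσ : (d : ℝ) < σ) : 0 < normConst d σ := by
  have h1 := Real.Gamma_pos_of_pos (sub_pos.2 hσ)
  have h2 := Real.Gamma_pos_of_pos (lt_of_le_of_lt d.cast_nonneg hσ)
  unfold normConst
  positivity

theorem one_sub_sqNorm_pos {d : ℕ} (z : unitBall d) : 0 < 1 - sqNorm (z : Fin d → ℂ) :=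
  sub_pos.2 z.2

theorem bergmanMeasure_eq {d : ℕ} {σ : ℝ} :
    bergmanMeasure d σ = ((volume : Measure (Fin d → ℂ)).comap Subtype.val).withDensity
      fun z : unitBall d => ENNReal.ofReal (normConst d σ) *
        posPow (σ - d) (1 - sqNorm (z : Fin d → ℂ)) := by
  have := @measurable_sqNorm_coe d
  unfold bergmanMeasure hyperbolicMeasure
  rw [← withDensity_mul _ (by fun_prop) (by fun_prop)]
  congr 1
  funext z
  have hz := one_sub_sqNorm_pos z
  rw [posPow, if_pos hz, Pi.mul_apply, ← ENNReal.ofReal_mul (by positivity),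
    ← ENNReal.ofReal_mul' (by positivity)]
  congr 1
  rw [mul_left_comm, ← Real.rpow_add hz]
  ring_nf

/-- `posPow` vanishes off the ball, so the integral can be taken over all of `ℂᵈ`. -/
theorem lintegral_bergmanMeasure {d : ℕ} {σ : ℝ} {g : (Fin d → ℂ) → ENNReal} (hg : Measurable g) :
    ∫⁻ z : unitBall d, g z ∂(bergmanMeasure d σ) = ENNReal.ofReal (normConst d σ) *
      ∫⁻ z, g z * posPow (σ - d) (1 - sqNorm z) := by
  have hp : Measurable fun z : Fin d → ℂ => posPow (σ - d) (1 - sqNorm z) :=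
    (measurable_posPow _).comp (measurable_const.sub measurable_sqNorm)
  rw [bergmanMeasure_eq]
  refine (lintegral_withDensity_eq_lintegral_mul _
    ((hp.comp measurable_subtype_coe).const_mul _) (hg.comp measurable_subtype_coe)).trans ?_
  refine (lintegral_subtype_comap (isOpen_unitBall d).measurableSet
    (fun z => ENNReal.ofReal (normConst d σ) * posPow (σ - d) (1 - sqNorm z) * g z)).trans ?_
  rw [setLIntegral_eq_of_support_subset]
  · rw [← lintegral_const_mul _ (show Measurable fun z => g z * posPow (σ - d) (1 - sqNorm z) from
      hg.mul hp)]
    exact lintegral_congr fun z => by ring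
  · intro z hz
    by_contra h
    refine hz ?_
    have : ¬ 0 < 1 - sqNorm z := fun h' => h (sub_pos.1 h')
    simp [posPow, this]

theorem lintegral_enorm_monomialFun_sq {d : ℕ} {σ : ℝ} (hσ : (d : ℝ) < σ) (m : Fin d → ℕ) :
    ∫⁻ z, ‖monomialFun m z‖ₑ ^ 2 ∂(bergmanMeasure d σ) = ENNReal.ofReal (monomialWeight σ m) := by
  have h0 : 0 < σ - d := sub_pos.2 hσ
  have hG := (Real.Gamma_pos_of_pos h0).ne'
  have h1 (z : unitBall d) : ‖monomialFun m z‖ₑ ^ 2 =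
      (fun z : Fin d → ℂ => ENNReal.ofReal (∏ j, (‖z j‖ ^ 2) ^ m j)) z := by
    rw [← ofReal_norm, ← ENNReal.ofReal_pow (norm_nonneg _), monomialFun, norm_prod,
      ← Finset.prod_pow]
    simp only [norm_pow, ← pow_mul, mul_comm]
  refine (lintegral_congr h1).trans ((lintegral_bergmanMeasure
    (g := fun z : Fin d → ℂ => ENNReal.ofReal (∏ j, (‖z j‖ ^ 2) ^ m j)) (by fun_prop)).trans ?_)
  rw [lintegral_monomial_mul_posPow d m h0,
    ← ENNReal.ofReal_mul (normConst_pos hσ).le, sub_add_cancel]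
  congr 1
  unfold normConst monomialWeight
  field_simp

theorem continuous_monomialFun {d : ℕ} (m : Fin d → ℕ) : Continuous (monomialFun m) := by
  unfold monomialFun
  exact continuous_finsetProd _ fun j _ =>
    ((continuous_apply j).comp continuous_subtype_val).pow _

theorem memLp_monomialFun {d : ℕ} {σ : ℝ} (hσ : (d : ℝ) < σ) (m : Fin d → ℕ) :
    MemLp (monomialFun m) 2 (bergmanMeasure d σ) := by
  refine ⟨(continuous_monomialFun m).aestronglyMeasurable, ?_⟩
  rw [eLpNorm_lt_top_iff_lintegral_rpow_enorm_lt_top two_ne_zero ENNReal.ofNat_ne_top]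
  simp only [ENNReal.toReal_ofNat, ENNReal.rpow_ofNat]
  rw [lintegral_enorm_monomialFun_sq hσ]
  exact ENNReal.ofReal_lt_top

/-! ### Torus action and orthogonality of monomials -/

/-- The coordinatewise rotation of the ball by a point of the torus. -/
noncomputable def rotate {d : ℕ} (u : Fin d → Circle) (z : unitBall d) : unitBall d :=
  ⟨fun j => u j * (z : Fin d → ℂ) j, by simpa [unitBall, sqNorm, Circle.norm_coe] using z.2⟩

theorem sqNorm_rotate {d : ℕ} (u : Fin d → Circle) (z : unitBall d) :
    sqNorm (rotate u z : Fin d → ℂ) = sqNorm (z : Fin d → ℂ) := by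
  simp [rotate, sqNorm, Circle.norm_coe]

theorem continuous_rotate {d : ℕ} : Continuous fun p : (Fin d → Circle) × unitBall d =>
    rotate p.1 p.2 := by
  refine Continuous.subtype_mk (continuous_pi fun j => ?_) _
  exact ((by fun_prop : Continuous ((↑) : Circle → ℂ)).comp ((continuous_apply j).comp continuous_fst)).mul
    ((continuous_apply j).comp (continuous_subtype_val.comp continuous_snd))

theorem monomialFun_rotate {d : ℕ} (m : Fin d → ℕ) (u : Fin d → Circle) (z : unitBall d) :
    monomialFun m (rotate u z) = (∏ j, (u j : ℂ) ^ m j) * monomialFun m z := by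
  simp [monomialFun, rotate, mul_pow, Finset.prod_mul_distrib]

theorem measurePreserving_rotate_comap {d : ℕ} (u : Fin d → Circle) :
    MeasurePreserving (rotate u) ((volume : Measure (Fin d → ℂ)).comap Subtype.val)
      ((volume : Measure (Fin d → ℂ)).comap Subtype.val) := by
  have hemb : MeasurableEmbedding (Subtype.val : unitBall d → Fin d → ℂ) :=
    .subtype_coe (isOpen_unitBall d).measurableSet
  have hvol : MeasurePreserving (fun (z : Fin d → ℂ) j => rotation (u j) (z j)) volume volume :=
    volume_preserving_pi fun j => (rotation (u j)).measurePreserving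
  have hmeas : Measurable (rotate u) := (continuous_rotate.comp (by fun_prop :
    Continuous fun z : unitBall d => (u, z))).measurable
  refine ⟨hmeas, Measure.ext fun s hs => ?_⟩
  rw [Measure.map_apply hmeas hs, hemb.comap_apply, hemb.comap_apply,
    ← hvol.measure_preimage (hemb.measurableSet_image.2 hs).nullMeasurableSet]
  congr 1
  ext z
  simp only [Set.mem_image, Set.mem_preimage, Subtype.exists, exists_and_right, exists_eq_right]
  have hz : (fun j => rotation (u j) (z j)) ∈ unitBall d ↔ z ∈ unitBall d := by
    simp [unitBall, sqNorm, Circle.norm_coe]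
  exact ⟨fun ⟨h, h'⟩ => ⟨hz.2 h, h'⟩, fun ⟨h, h'⟩ => ⟨hz.1 h, h'⟩⟩

/-- The density depends on `|z|²` alone, which rotations fix. -/
theorem measurePreserving_rotate {d : ℕ} (σ : ℝ) (u : Fin d → Circle) :
    MeasurePreserving (rotate u) (bergmanMeasure d σ) (bergmanMeasure d σ) := by
  have h := measurePreserving_rotate_comap u
  have hp : Measurable fun z : unitBall d => ENNReal.ofReal (normConst d σ) *
      posPow (σ - d) (1 - sqNorm (z : Fin d → ℂ)) :=
    ((measurable_posPow _).comp (measurable_const.sub measurable_sqNorm_coe)).const_mul _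
  refine ⟨h.measurable, Measure.ext fun s hs => ?_⟩
  rw [Measure.map_apply h.measurable hs, bergmanMeasure_eq, withDensity_apply _ hs,
    withDensity_apply _ (h.measurable hs), ← h.setLIntegral_comp_preimage hs hp]
  simp only [sqNorm_rotate]

theorem bergmanInner_monomialFun_of_ne {d : ℕ} (σ : ℝ) {l m : Fin d → ℕ} (hlm : l ≠ m) :
    bergmanInner σ (monomialFun l) (monomialFun m) = 0 := by
  obtain ⟨j, hj⟩ := Function.ne_iff.1 hlm
  -- Rotating the `j`-th coordinate by this angle multiplies `conj (z^l) * z^m` by `exp (iπ) = -1`,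
  -- so the integral equals its own negative.
  let t : ℝ := Real.pi / ((m j : ℝ) - l j)
  let u : Fin d → Circle := Function.update 1 j (Circle.exp t)
  have hu (k : Fin d → ℕ) : ∏ i, (u i : ℂ) ^ k i = Complex.exp (k j * (t * Complex.I)) := by
    rw [Finset.prod_eq_single j (fun i _ hi => by simp [u, hi]) (by simp)]
    simp [u, Complex.exp_nat_mul]
  have hc : conj (∏ i, (u i : ℂ) ^ l i) * ∏ i, (u i : ℂ) ^ m i = -1 := by
    rw [hu, hu, ← Complex.exp_conj, ← Complex.exp_add, ← Complex.exp_pi_mul_I]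
    congr 1
    have : ((m j : ℂ) - l j) ≠ 0 := by
      rw [sub_ne_zero]; exact_mod_cast Ne.symm hj
    simp only [map_mul, Complex.conj_natCast, Complex.conj_ofReal, Complex.conj_I, t]
    push_cast
    field_simp
    ring
  have hinv : bergmanInner σ (monomialFun l) (monomialFun m) =
      -bergmanInner σ (monomialFun l) (monomialFun m) := by
    have hmp := measurePreserving_rotate σ u
    have hcont : Continuous fun z => conj (monomialFun l z) * monomialFun m z :=
      (Complex.continuous_conj.comp (continuous_monomialFun l)).mul (continuous_monomialFun m)
    unfold bergmanInner
    conv_lhs => rw [← hmp.map_eq]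
    rw [integral_map hmp.measurable.aemeasurable hcont.aestronglyMeasurable, ← integral_neg]
    refine integral_congr_ae (.of_forall fun z => ?_)
    simp only [monomialFun_rotate, map_mul]
    linear_combination conj (monomialFun l z) * monomialFun m z * hc
  exact self_eq_neg.1 hinv

theorem integral_norm_sq_eq_toReal_lintegral {α : Type*} [MeasurableSpace α] {μ : Measure α}
    {f : α → ℂ} (hf : AEStronglyMeasurable f μ) :
    ∫ z, ‖f z‖ ^ 2 ∂μ = (∫⁻ z, ‖f z‖ₑ ^ 2 ∂μ).toReal := by
  rw [integral_eq_lintegral_of_nonneg_ae (.of_forall fun z => by positivity) (by fun_prop)]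
  congr 1
  refine lintegral_congr fun z => ?_
  rw [← ofReal_norm, ENNReal.ofReal_pow (norm_nonneg _)]

theorem bergmanInner_self {d : ℕ} (σ : ℝ) (f : unitBall d → ℂ) :
    bergmanInner σ f f = ((∫ z, ‖f z‖ ^ 2 ∂(bergmanMeasure d σ) : ℝ) : ℂ) := by
  rw [bergmanInner, ← integral_complex_ofReal]
  simp [Complex.conj_mul']

theorem bergmanInner_monomialFun {d : ℕ} {σ : ℝ} (hσ : (d : ℝ) < σ) (l m : Fin d → ℕ) :
    bergmanInner σ (monomialFun l) (monomialFun m) =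
      if l = m then (monomialWeight σ m : ℂ) else 0 := by
  split_ifs with h
  · subst h
    rw [bergmanInner_self, integral_norm_sq_eq_toReal_lintegral
      (continuous_monomialFun l).aestronglyMeasurable, lintegral_enorm_monomialFun_sq hσ,
      ENNReal.toReal_ofReal (monomialWeight_pos (lt_of_le_of_lt d.cast_nonneg hσ) l).le]
  · exact bergmanInner_monomialFun_of_ne σ h

/-- Pythagoras for finitely many orthogonal monomials, put in `ENNReal` so that it can be summed
over degrees without integrability conditions. -/
theorem lintegral_enorm_sum_monomialFun_sq {d : ℕ} {σ : ℝ} (hσ : (d : ℝ) < σ)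
    (s : Finset (Fin d → ℕ)) (a : (Fin d → ℕ) → ℂ) :
    ∫⁻ z, ‖∑ m ∈ s, a m * monomialFun m z‖ₑ ^ 2 ∂(bergmanMeasure d σ) =
      ∑ m ∈ s, ENNReal.ofReal (‖a m‖ ^ 2 * monomialWeight σ m) := by
  have hpos := monomialWeight_pos (d := d) (lt_of_le_of_lt d.cast_nonneg hσ)
  have hmem : MemLp (fun z => ∑ m ∈ s, a m * monomialFun m z) 2 (bergmanMeasure d σ) :=
    memLp_finsetSum _ fun m _ => (memLp_monomialFun hσ m).const_mul _
  have hint : Integrable (fun z => ‖∑ m ∈ s, a m * monomialFun m z‖ ^ 2) (bergmanMeasure d σ) :=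
    hmem.integrable_norm_pow two_ne_zero
  have key : ∫ z, ‖∑ m ∈ s, a m * monomialFun m z‖ ^ 2 ∂(bergmanMeasure d σ) =
      ∑ m ∈ s, ‖a m‖ ^ 2 * monomialWeight σ m := by
    apply Complex.ofReal_injective
    rw [← bergmanInner_self σ (fun z => ∑ m ∈ s, a m * monomialFun m z)]
    have hlm (l m : Fin d → ℕ) : Integrable (fun z => conj (monomialFun l z) * monomialFun m z)
        (bergmanMeasure d σ) :=
      (memLp_monomialFun hσ l).star.integrable_mul (memLp_monomialFun hσ m)
    have : bergmanInner σ (fun z => ∑ m ∈ s, a m * monomialFun m z)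
        (fun z => ∑ m ∈ s, a m * monomialFun m z) = ∑ l ∈ s, ∑ m ∈ s, conj (a l) * a m *
          bergmanInner σ (monomialFun l) (monomialFun m) := by
      have h (z : unitBall d) : conj (∑ m ∈ s, a m * monomialFun m z) *
          (∑ m ∈ s, a m * monomialFun m z) = ∑ l ∈ s, ∑ m ∈ s, conj (a l) * a m *
            (conj (monomialFun l z) * monomialFun m z) := by
        rw [map_sum, Finset.sum_mul_sum]
        refine Finset.sum_congr rfl fun l _ => Finset.sum_congr rfl fun m _ => ?_
        rw [map_mul]; ring
      unfold bergmanInner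
      simp_rw [h]
      rw [integral_finsetSum _ fun l _ => integrable_finsetSum _ fun m _ => (hlm l m).const_mul _]
      refine Finset.sum_congr rfl fun l _ => ?_
      rw [integral_finsetSum _ fun m _ => (hlm l m).const_mul _]
      exact Finset.sum_congr rfl fun m _ => integral_const_mul _ _
    rw [this, Complex.ofReal_sum]
    refine Finset.sum_congr rfl fun l hl => ?_
    simp only [bergmanInner_monomialFun hσ, mul_ite, mul_zero, Finset.sum_ite_eq, hl, if_true]
    rw [Complex.conj_mul']
    push_cast
    rfl
  rw [← ENNReal.ofReal_sum_of_nonneg fun m _ => mul_nonneg (by positivity) (hpos m).le, ← key,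
    ofReal_integral_eq_lintegral_ofReal hint (.of_forall fun z => by positivity)]
  refine lintegral_congr fun z => ?_
  rw [← ofReal_norm, ENNReal.ofReal_pow (norm_nonneg _)]

/-! ### Grouping by degree, and Parseval on the circle -/

/-- The multi-indices of degree `k`. -/
def degreeSet (d k : ℕ) : Finset (Fin d → ℕ) := Finset.piAntidiag Finset.univ k

theorem mem_degreeSet {d k : ℕ} {m : Fin d → ℕ} : m ∈ degreeSet d k ↔ ∑ j, m j = k := by
  simp [degreeSet]

theorem coe_degreeSet (d k : ℕ) :
    (degreeSet d k : Set (Fin d → ℕ)) = (fun m : Fin d → ℕ => ∑ j, m j) ⁻¹' {k} := by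
  ext m
  simp [mem_degreeSet]

theorem HasSum.sum_degreeSet {d : ℕ} {E : Type*} [NormedAddCommGroup E] [CompleteSpace E]
    {g : (Fin d → ℕ) → E} {a : E} (h : HasSum g a) :
    HasSum (fun k => ∑ m ∈ degreeSet d k, g m) a := by
  convert h.tsum_fiberwise (fun m => ∑ j, m j) using 2 with k
  rw [← coe_degreeSet, Finset.tsum_subtype']

theorem ENNReal.tsum_sum_degreeSet {d : ℕ} (g : (Fin d → ℕ) → ENNReal) :
    ∑' k, ∑ m ∈ degreeSet d k, g m = ∑' m, g m := by
  rw [← ENNReal.tsum_fiberwise g fun m => ∑ j, m j]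
  congr 1
  ext k
  rw [← coe_degreeSet, Finset.tsum_subtype']

/-- Absolute summability makes the series converge uniformly on the circle, hence in `L²`, where the
exponentials are orthonormal. -/
theorem lintegral_haarAddCircle_enorm_power_series_sq {c : ℕ → ℂ} (hc : Summable fun k => ‖c k‖)
    {F : UnitAddCircle → ℂ} (hF : ∀ θ, HasSum (fun k => c k * (θ.toCircle : ℂ) ^ k) (F θ)) :
    ∫⁻ θ, ‖F θ‖ₑ ^ 2 ∂(AddCircle.haarAddCircle : Measure UnitAddCircle) =
      ∑' k, ENNReal.ofReal (‖c k‖ ^ 2) := by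
  have hG : Summable fun k : ℕ => c k • (fourier (k : ℤ) : C(UnitAddCircle, ℂ)) :=
    Summable.of_norm (by simpa [norm_smul, fourier_norm] using hc)
  obtain ⟨G, hG⟩ := hG
  have hGF : (G : UnitAddCircle → ℂ) = F := by
    funext θ
    refine (ContinuousMap.hasSum_apply hG θ).unique ?_
    simpa [fourier_apply, AddCircle.toCircle_nsmul] using hF θ
  let L := ContinuousMap.toLp (E := ℂ) 2 (AddCircle.haarAddCircle : Measure UnitAddCircle) ℂ
  have hL : HasSum (fun k : ℕ => c k • fourierLp (T := 1) 2 (k : ℤ)) (L G) := by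
    simpa using L.hasSum hG
  have horth : Orthonormal ℂ fun k : ℕ => fourierLp (T := 1) 2 (k : ℤ) :=
    orthonormal_fourier.comp _ Nat.cast_injective
  have hsq : HasSum (fun k => ‖c k‖ ^ 2) (‖L G‖ ^ 2) := by
    have h1 := (Filter.Tendsto.norm hL).pow 2
    refine h1.congr fun s => ?_
    rw [← Complex.ofReal_inj, Complex.ofReal_pow]
    refine (inner_self_eq_norm_sq_to_K (𝕜 := ℂ) _).symm.trans ((horth.inner_sum c c s).trans ?_)
    push_cast
    exact Finset.sum_congr rfl fun k _ => Complex.conj_mul' _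
  rw [← ENNReal.ofReal_tsum_of_nonneg (fun k => by positivity) hsq.summable, hsq.tsum_eq,
    ENNReal.ofReal_pow (norm_nonneg _), ofReal_norm, Lp.enorm_def]
  have h2 := eLpNorm_nnreal_pow_eq_lintegral (f := L G) (p := 2)
    (μ := (AddCircle.haarAddCircle : Measure UnitAddCircle)) two_ne_zero
  simp only [NNReal.coe_ofNat, ENNReal.rpow_ofNat, ENNReal.coe_ofNat] at h2
  rw [h2]
  refine lintegral_congr_ae ?_
  filter_upwards [ContinuousMap.coeFn_toLp (𝕜 := ℂ) (p := 2)
    (AddCircle.haarAddCircle : Measure UnitAddCircle) G] with θ hθ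
  rw [show (L G) θ = G θ from hθ, hGF]

/-! ### Homogeneous expansions and the norm formula -/

/-- `f` is the pointwise sum of the series of the homogeneous polynomials with coefficients `a`. -/
def HasHomogeneousExpansion {d : ℕ} (f : unitBall d → ℂ) (a : (Fin d → ℕ) → ℂ) : Prop :=
  ∀ z, HasSum (fun k => ∑ m ∈ degreeSet d k, a m * monomialFun m z) (f z)

theorem sqNorm_smul {d : ℕ} (ζ : ℂ) (z : Fin d → ℂ) : sqNorm (ζ • z) = ‖ζ‖ ^ 2 * sqNorm z := by
  simp [sqNorm, mul_pow, Finset.mul_sum]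

theorem sqNorm_nonneg {d : ℕ} (z : Fin d → ℂ) : 0 ≤ sqNorm z :=
  Finset.sum_nonneg fun _ _ => by positivity

theorem exists_smul_mem_unitBall {d : ℕ} (z : unitBall d) :
    ∃ r : ℝ, 1 < r ∧ ∀ ζ : ℂ, ‖ζ‖ < r → ζ • (z : Fin d → ℂ) ∈ unitBall d := by
  have h0 := sqNorm_nonneg (z : Fin d → ℂ)
  have h1 : sqNorm (z : Fin d → ℂ) < 1 := z.2
  -- The square of this radius lies strictly between `1` and `1 / |z|²`.
  refine ⟨√(2 / (1 + sqNorm (z : Fin d → ℂ))), ?_, fun ζ hζ => ?_⟩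
  · rw [Real.lt_sqrt zero_le_one, lt_div_iff₀ (by positivity)]
    linarith
  · rw [Real.lt_sqrt (norm_nonneg _), lt_div_iff₀ (by positivity)] at hζ
    change sqNorm _ < 1
    rw [sqNorm_smul]
    nlinarith [norm_nonneg ζ]

theorem monomialFun_smul {d k : ℕ} {m : Fin d → ℕ} (hm : m ∈ degreeSet d k) (ζ : ℂ)
    (z : unitBall d) (hz : ζ • (z : Fin d → ℂ) ∈ unitBall d) :
    monomialFun m ⟨ζ • (z : Fin d → ℂ), hz⟩ = ζ ^ k * monomialFun m z := by
  simp [monomialFun, mul_pow, Finset.prod_mul_distrib, Finset.prod_pow_eq_pow_sum,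
    mem_degreeSet.1 hm]

theorem sum_degreeSet_smul {d k : ℕ} (a : (Fin d → ℕ) → ℂ) (ζ : ℂ)
    (z : unitBall d) (hz : ζ • (z : Fin d → ℂ) ∈ unitBall d) :
    ∑ m ∈ degreeSet d k, a m * monomialFun m ⟨ζ • (z : Fin d → ℂ), hz⟩ =
      (∑ m ∈ degreeSet d k, a m * monomialFun m z) * ζ ^ k := by
  rw [Finset.sum_mul]
  refine Finset.sum_congr rfl fun m hm => ?_
  rw [monomialFun_smul hm]
  ring

/-- The series also converges at `t z` for some `t > 1`. Its terms there are bounded, so those at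
`z` are at most `C t^(-k)`. -/
theorem HasHomogeneousExpansion.summable_norm {d : ℕ} {f : unitBall d → ℂ}
    {a : (Fin d → ℕ) → ℂ} (h : HasHomogeneousExpansion f a) (z : unitBall d) :
    Summable fun k => ‖∑ m ∈ degreeSet d k, a m * monomialFun m z‖ := by
  obtain ⟨r, hr, hball⟩ := exists_smul_mem_unitBall z
  obtain ⟨t, ht1, htr⟩ := exists_between hr
  have ht0 : 0 < t := one_pos.trans ht1
  have hz := hball t (by simpa [abs_of_pos ht0] using htr)
  have hs := (h ⟨_, hz⟩).summable
  simp only [sum_degreeSet_smul] at hs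
  obtain ⟨C, hC⟩ := (hs.tendsto_cofinite_zero.norm).bddAbove_range_of_cofinite
  refine Summable.of_nonneg_of_le (fun _ => norm_nonneg _) (fun k => ?_)
    ((summable_geometric_of_lt_one (by positivity) (inv_lt_one_of_one_lt₀ ht1)).mul_left C)
  have := hC ⟨k, rfl⟩
  simp only [norm_mul, norm_pow, Complex.norm_real, Real.norm_eq_abs, abs_of_pos ht0] at this
  rw [inv_pow, ← div_eq_mul_inv, le_div_iff₀ (by positivity)]
  exact this

instance isFiniteMeasure_bergmanMeasure {d : ℕ} {σ : ℝ} [hσ : Fact ((d : ℝ) < σ)] :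
    IsFiniteMeasure (bergmanMeasure d σ) := by
  constructor
  have h := lintegral_enorm_monomialFun_sq hσ.out (0 : Fin d → ℕ)
  simp only [monomialFun, Pi.zero_apply, pow_zero, Finset.prod_const_one, enorm_one, one_pow,
    lintegral_one] at h
  rw [h]
  exact ENNReal.ofReal_lt_top

theorem HasHomogeneousExpansion.measurable {d : ℕ} {f : unitBall d → ℂ}
    {a : (Fin d → ℕ) → ℂ} (h : HasHomogeneousExpansion f a) : Measurable f := by
  refine measurable_of_tendsto_metrizable (f := fun n z => ∑ k ∈ Finset.range n,
    ∑ m ∈ degreeSet d k, a m * monomialFun m z) (fun n => ?_)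
    (tendsto_pi_nhds.2 fun z => (h z).tendsto_sum_nat)
  have := fun m : Fin d → ℕ => (continuous_monomialFun m).measurable
  fun_prop

/-- Averaging over the rotations `z ↦ exp (iθ) z` does not change the integral. After Tonelli,
Parseval in `θ` removes the cross terms between different degrees, and within one degree the sum is
finite. As `f` is not assumed square-integrable, this also decides membership in `L²`. -/
theorem HasHomogeneousExpansion.lintegral_enorm_sq {d : ℕ} {σ : ℝ} (hσ : (d : ℝ) < σ)
    {f : unitBall d → ℂ} {a : (Fin d → ℕ) → ℂ} (h : HasHomogeneousExpansion f a) :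
    ∫⁻ z, ‖f z‖ₑ ^ 2 ∂(bergmanMeasure d σ) =
      ∑' m, ENNReal.ofReal (‖a m‖ ^ 2 * monomialWeight σ m) := by
  have : Fact ((d : ℝ) < σ) := ⟨hσ⟩
  let ν : Measure UnitAddCircle := AddCircle.haarAddCircle
  have hf := h.measurable
  have hmon := fun m : Fin d → ℕ => (continuous_monomialFun m).measurable
  have hrot : Measurable fun p : UnitAddCircle × unitBall d =>
      rotate (fun _ => p.1.toCircle) p.2 :=
    (continuous_rotate.comp (by
      have : Continuous (AddCircle.toCircle : UnitAddCircle → Circle) := AddCircle.continuous_toCircle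
      fun_prop : Continuous fun p : UnitAddCircle × unitBall d =>
        ((fun _ => p.1.toCircle : Fin d → Circle), p.2))).measurable
  calc ∫⁻ z, ‖f z‖ₑ ^ 2 ∂(bergmanMeasure d σ)
      = ∫⁻ θ, ∫⁻ z, ‖f (rotate (fun _ => θ.toCircle) z)‖ₑ ^ 2 ∂(bergmanMeasure d σ) ∂ν := by
        have h1 (θ : UnitAddCircle) : ∫⁻ z, ‖f (rotate (fun _ => θ.toCircle) z)‖ₑ ^ 2
            ∂(bergmanMeasure d σ) = ∫⁻ z, ‖f z‖ₑ ^ 2 ∂(bergmanMeasure d σ) :=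
          (measurePreserving_rotate σ fun _ => θ.toCircle).lintegral_comp
            (f := fun z => ‖f z‖ₑ ^ 2) (by fun_prop)
        simp [h1]
    _ = ∫⁻ z, ∫⁻ θ, ‖f (rotate (fun _ => θ.toCircle) z)‖ₑ ^ 2 ∂ν ∂(bergmanMeasure d σ) :=
        lintegral_lintegral_swap
          ((((hf.comp hrot).enorm).pow_const 2).aemeasurable)
    _ = ∫⁻ z, ∑' k, ENNReal.ofReal (‖∑ m ∈ degreeSet d k, a m * monomialFun m z‖ ^ 2)
          ∂(bergmanMeasure d σ) := by
        refine lintegral_congr fun z => lintegral_haarAddCircle_enorm_power_series_sq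
          (h.summable_norm z) fun θ => ?_
        convert h (rotate (fun _ => θ.toCircle) z) using 2 with k
        rw [Finset.sum_mul]
        refine Finset.sum_congr rfl fun m hm => ?_
        rw [monomialFun_rotate, Finset.prod_pow_eq_pow_sum, mem_degreeSet.1 hm]
        ring
    _ = ∑' k, ∑ m ∈ degreeSet d k, ENNReal.ofReal (‖a m‖ ^ 2 * monomialWeight σ m) := by
        rw [lintegral_tsum fun k => by fun_prop]
        congr 1
        ext k
        rw [← lintegral_enorm_sum_monomialFun_sq hσ]
        refine lintegral_congr fun z => ?_
        rw [ENNReal.ofReal_pow (norm_nonneg _), ofReal_norm]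
    _ = _ := ENNReal.tsum_sum_degreeSet _

/-- By the norm formula the zero function has only zero coefficients; any `σ > d` serves, here `d +
1`. -/
theorem HasHomogeneousExpansion.unique {d : ℕ} {f : unitBall d → ℂ} {a b : (Fin d → ℕ) → ℂ}
    (ha : HasHomogeneousExpansion f a) (hb : HasHomogeneousExpansion f b) : a = b := by
  have h0 : HasHomogeneousExpansion (0 : unitBall d → ℂ) (a - b) := fun z => by
    simpa [sub_mul] using (ha z).sub (hb z)
  have hσ : (d : ℝ) < d + 1 := by linarith
  have h := h0.lintegral_enorm_sq hσ
  simp only [Pi.zero_apply, enorm_zero, ne_eq, OfNat.ofNat_ne_zero, not_false_eq_true, zero_pow,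
    lintegral_zero] at h
  funext m
  have hm := ENNReal.tsum_eq_zero.1 h.symm m
  have hw := monomialWeight_pos (s := (d : ℝ) + 1) (by positivity) m
  rw [ENNReal.ofReal_eq_zero] at hm
  have : ‖(a - b) m‖ ^ 2 ≤ 0 := by
    by_contra hc
    exact absurd hm (not_le.2 (mul_pos (not_le.1 hc) hw))
  have h2 : ‖(a - b) m‖ = 0 := by
    simpa using le_antisymm this (by positivity)
  exact sub_eq_zero.1 (norm_eq_zero.1 h2)

theorem HasSum.of_eq {ι E : Type*} [AddCommMonoid E] [TopologicalSpace E] {f g : ι → E} {a b : E}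
    (h : HasSum f a) (hfg : ∀ i, g i = f i) (hab : b = a) : HasSum g b := by
  rw [hab, funext hfg]
  exact h

/-! ### Cauchy's formula on polydiscs and power series at the origin -/

/-- Absolute summability is carried through the induction because multiplying two series requires
it. -/
theorem hasSum_prod_geometric {𝕜 : Type*} [NormedField 𝕜] [CompleteSpace 𝕜] {d : ℕ}
    (x : Fin d → 𝕜) (hx : ∀ j, ‖x j‖ < 1) :
    HasSum (fun m : Fin d → ℕ => ∏ j, x j ^ m j) (∏ j, (1 - x j))⁻¹ ∧
      Summable (fun m : Fin d → ℕ => ‖∏ j, x j ^ m j‖) := by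
  induction d with
  | zero => exact ⟨by simp, .of_finite⟩
  | succ d ih =>
    obtain ⟨h1, h2⟩ := ih (fun j => x j.succ) fun j => hx _
    have h3 := hasSum_geometric_of_norm_lt_one (hx 0)
    have h4 : Summable fun n => ‖x 0 ^ n‖ := by
      simpa using summable_geometric_of_lt_one (norm_nonneg _) (hx 0)
    rw [← (Fin.consEquiv fun _ => ℕ).hasSum_iff, ← (Fin.consEquiv fun _ => ℕ).summable_iff]
    simp only [Function.comp_def, Fin.consEquiv_apply, Fin.prod_univ_succ, Fin.cons_zero,
      Fin.cons_succ]
    have h5 := h3.mul h1 (summable_mul_of_summable_norm (f := fun n => x 0 ^ n)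
      (g := fun m : Fin d → ℕ => ∏ j, x j.succ ^ m j) h4 h2)
    rw [mul_inv]
    refine ⟨h5, ?_⟩
    simpa only [norm_mul] using h4.mul_of_nonneg h2 (fun _ => norm_nonneg _) fun _ => norm_nonneg _

theorem continuous_torusMap {d : ℕ} (c : Fin d → ℂ) (R : Fin d → ℝ) :
    Continuous (torusMap c R) := by
  unfold torusMap; fun_prop

theorem norm_torusMap_zero_apply {d : ℕ} {r : ℝ} (hr : 0 < r) (θ : Fin d → ℝ) (j : Fin d) :
    ‖torusMap 0 (fun _ => r) θ j‖ = r := by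
  simp [torusMap, abs_of_pos hr]

theorem torusMap_mem_closedBall {d : ℕ} {r : ℝ} (hr : 0 < r) (θ : Fin d → ℝ) :
    torusMap 0 (fun _ => r) θ ∈ Metric.closedBall (0 : Fin d → ℂ) r := by
  rw [mem_closedBall_zero_iff, pi_norm_le_iff_of_nonneg hr.le]
  exact fun j => (norm_torusMap_zero_apply hr θ j).le

/-- The one-variable Cauchy formula, one coordinate at a time. The closed ball of the sup norm is a
closed polydisc, so freezing a coordinate stays inside it. -/
theorem torusIntegral_prod_sub_inv_mul {d : ℕ} {r : ℝ} (hr : 0 < r) {f : (Fin d → ℂ) → ℂ}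
    (hf : DifferentiableOn ℂ f (Metric.closedBall 0 r)) {z : Fin d → ℂ} (hz : ∀ j, ‖z j‖ < r) :
    (∯ w in T(0, fun _ => r), (∏ j, (w j - z j))⁻¹ * f w) =
      (2 * Real.pi * Complex.I) ^ d * f z := by
  induction d with
  | zero => simp [torusIntegral_dim0, Subsingleton.elim (0 : Fin 0 → ℂ) z]
  | succ d ih =>
    have hint : TorusIntegrable (fun w : Fin (d + 1) → ℂ => (∏ j, (w j - z j))⁻¹ * f w) 0
        fun _ => r := by
      refine ContinuousOn.integrableOn_compact isCompact_Icc (Continuous.continuousOn ?_)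
      have hc := continuous_torusMap (0 : Fin (d + 1) → ℂ) fun _ => r
      refine Continuous.mul (Continuous.inv₀ ?_ fun θ => ?_)
        (hf.continuousOn.comp_continuous hc (torusMap_mem_closedBall hr))
      · exact continuous_finsetProd _ fun j _ =>
          ((continuous_apply j).comp hc).sub continuous_const
      · refine Finset.prod_ne_zero_iff.2 fun j _ => sub_ne_zero.2 fun h => ?_
        have := norm_torusMap_zero_apply hr θ j
        rw [h] at this
        exact (hz j).ne this
    have hcons {x : ℂ} (hx : ‖x‖ ≤ r) {y : Fin d → ℂ} (hy : y ∈ Metric.closedBall 0 r) :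
        (Fin.cons x y : Fin (d + 1) → ℂ) ∈ Metric.closedBall 0 r := by
      rw [mem_closedBall_zero_iff, pi_norm_le_iff_of_nonneg hr.le] at hy ⊢
      exact Fin.cases hx hy
    have hz' : (fun j : Fin d => z j.succ) ∈ Metric.closedBall 0 r := by
      rw [mem_closedBall_zero_iff, pi_norm_le_iff_of_nonneg hr.le]
      exact fun j => (hz _).le
    have hinner {x : ℂ} (hx : ‖x‖ ≤ r) :
        (∯ y in T((0 : Fin d → ℂ), fun _ => r), (∏ j, ((Fin.cons x y : Fin (d + 1) → ℂ) j - z j))⁻¹ *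
          f (Fin.cons x y)) = (x - z 0)⁻¹ * ((2 * Real.pi * Complex.I) ^ d *
            f (Fin.cons x fun j => z j.succ)) := by
      rw [← ih (f := fun y => f (Fin.cons x y)) (z := fun j => z j.succ) ?_ fun j => hz _,
        ← torusIntegral_const_mul]
      · simp only [Fin.prod_univ_succ, Fin.cons_zero, Fin.cons_succ, mul_inv, mul_assoc]
      · refine hf.comp (Differentiable.differentiableOn ?_) fun y hy => hcons hx hy
        refine differentiable_pi.2 (Fin.cases ?_ fun j => ?_)
        · simp
        · simpa using differentiable_apply j
    rw [torusIntegral_succ hint]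
    have hcirc : (∮ x in C(0, r), (x - z 0)⁻¹ * ((2 * Real.pi * Complex.I) ^ d *
        f (Fin.cons x fun j => z j.succ))) = (2 * Real.pi * Complex.I) ^ (d + 1) * f z := by
      have hd : DiffContOnCl ℂ (fun x : ℂ => (2 * Real.pi * Complex.I) ^ d *
          f (Fin.cons x fun j => z j.succ : Fin (d + 1) → ℂ)) (Metric.ball 0 r) := by
        refine DifferentiableOn.diffContOnCl_ball (U := Metric.closedBall 0 r) ?_ subset_rfl
        refine DifferentiableOn.const_mul (hf.comp (Differentiable.differentiableOn ?_)
          fun x hx => hcons (mem_closedBall_zero_iff.1 hx) hz') _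
        refine differentiable_pi.2 (Fin.cases ?_ fun j => ?_)
        · simp
        · simp
      have := hd.circleIntegral_sub_inv_smul (w := z 0) (mem_ball_zero_iff.2 (hz 0))
      simp only [smul_eq_mul] at this
      rw [this, ← Fin.cons_self_tail z, pow_succ]
      simp only [Fin.cons_zero]
      simp only [Fin.cons_succ]
      ring
    rw [← hcirc]
    refine circleIntegral.integral_congr hr.le fun x hx => hinner ?_
    simpa using (mem_sphere_zero_iff_norm.1 hx).le

/-- On the torus the Cauchy kernel is a product of geometric series in `z j / w j`. It is integrated
term by term, dominated by `M ∏ (|z j| / r)^(m j)` with `M` a bound of `|f|` on the torus. -/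
theorem exists_hasSum_monomial_of_differentiableOn_closedBall {d : ℕ} {r : ℝ} (hr : 0 < r)
    {f : (Fin d → ℂ) → ℂ} (hf : DifferentiableOn ℂ f (Metric.closedBall 0 r)) :
    ∃ a : (Fin d → ℕ) → ℂ, ∀ z : Fin d → ℂ, (∀ j, ‖z j‖ < r) →
      HasSum (fun m => a m * ∏ j, z j ^ m j) (f z) := by
  have h2 : (2 * Real.pi * Complex.I : ℂ) ^ d ≠ 0 := pow_ne_zero _ (by simp [Real.pi_ne_zero])
  refine ⟨fun m => ((2 * Real.pi * Complex.I) ^ d)⁻¹ *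
    ∯ w in T(0, fun _ => r), (∏ j, w j ^ (m j + 1))⁻¹ * f w, fun z hz => ?_⟩
  have hcont : Continuous fun θ : Fin d → ℝ => f (torusMap 0 (fun _ => r) θ) :=
    hf.continuousOn.comp_continuous (continuous_torusMap _ _) (torusMap_mem_closedBall hr)
  obtain ⟨M, hM⟩ := (isCompact_Icc (a := (0 : Fin d → ℝ)) (b := fun _ => 2 * Real.pi)).exists_bound_of_continuousOn
    hcont.continuousOn
  have hne (θ : Fin d → ℝ) (j : Fin d) : torusMap 0 (fun _ => r) θ j ≠ 0 := fun h => by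
    have := norm_torusMap_zero_apply hr θ j
    rw [h, norm_zero] at this
    exact hr.ne this
  have hx (j : Fin d) : ‖(‖z j‖ / r)‖ < 1 := by
    rw [Real.norm_of_nonneg (by positivity), div_lt_one hr]
    exact hz j
  have key : HasSum (fun m : Fin d → ℕ => (∯ w in T(0, fun _ => r),
      (∏ j, w j ^ (m j + 1))⁻¹ * f w) * ∏ j, z j ^ m j)
      (∯ w in T(0, fun _ => r), (∏ j, (w j - z j))⁻¹ * f w) := by
    simp only [torusIntegral, ← integral_mul_const]
    refine hasSum_integral_of_dominated_convergence
      (fun m _ => M * ∏ j, (‖z j‖ / r) ^ m j) (fun m => ?_) (fun m => ?_)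
      (.of_forall fun _ => (hasSum_prod_geometric _ hx).1.summable.mul_left M) ?_
      (.of_forall fun θ => ?_)
    · refine Continuous.aestronglyMeasurable ?_
      have hJ : Continuous fun θ : Fin d → ℝ =>
          ∏ j, (r : ℂ) * Complex.exp (θ j * Complex.I) * Complex.I :=
        continuous_finsetProd _ fun j _ => by fun_prop
      refine (hJ.smul (Continuous.mul (Continuous.inv₀ ?_ ?_) hcont)).mul continuous_const
      · exact continuous_finsetProd _ fun j _ => Continuous.pow
          ((continuous_apply j).comp (continuous_torusMap 0 fun _ => r)) _
      · exact fun θ => Finset.prod_ne_zero_iff.2 fun j _ => pow_ne_zero _ (hne θ j)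
    · filter_upwards [ae_restrict_mem measurableSet_Icc] with θ hθ
      have hMθ := hM θ hθ
      simp only [norm_smul, norm_mul, norm_inv, norm_prod, norm_pow, norm_torusMap_zero_apply hr,
        Complex.norm_I, Complex.norm_real, Complex.norm_exp_ofReal_mul_I, mul_one,
        Real.norm_of_nonneg hr.le]
      have h5 : (∏ _j : Fin d, r) * ((∏ j, r ^ (m j + 1))⁻¹ * ‖f (torusMap 0 (fun _ => r) θ)‖) *
          ∏ j, ‖z j‖ ^ m j = ‖f (torusMap 0 (fun _ => r) θ)‖ * ∏ j, (‖z j‖ / r) ^ m j := by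
        simp only [pow_succ, Finset.prod_mul_distrib, div_pow, Finset.prod_div_distrib]
        have h6 : ∏ j, r ^ m j ≠ 0 := Finset.prod_ne_zero_iff.2 fun j _ => by positivity
        have h7 : ∏ _j : Fin d, r ≠ 0 := Finset.prod_ne_zero_iff.2 fun j _ => hr.ne'
        field_simp
      rw [h5]
      gcongr
    · exact (continuous_const.integrableOn_Icc)
    · have hgeo := (hasSum_prod_geometric (fun j => z j / torusMap 0 (fun _ => r) θ j) fun j => by
        rw [norm_div, norm_torusMap_zero_apply hr, div_lt_one hr]; exact hz j).1
      have h8 := hgeo.mul_left ((∏ j, (r : ℂ) * Complex.exp (θ j * Complex.I) * Complex.I) •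
        ((∏ j, torusMap 0 (fun _ => r) θ j)⁻¹ * f (torusMap 0 (fun _ => r) θ)))
      refine h8.of_eq (fun m => ?_) ?_
      · simp only [pow_succ, Finset.prod_mul_distrib, div_pow, Finset.prod_div_distrib, mul_inv,
          smul_eq_mul]
        ring
      · have : ∏ j, (torusMap 0 (fun _ => r) θ j - z j) = (∏ j, torusMap 0 (fun _ => r) θ j) *
            ∏ j, (1 - z j / torusMap 0 (fun _ => r) θ j) := by
          rw [← Finset.prod_mul_distrib]
          refine Finset.prod_congr rfl fun j _ => ?_
          have := hne θ j
          field_simp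
        simp only [smul_eq_mul, this, mul_inv]
        ring
  rw [torusIntegral_prod_sub_inv_mul hr hf hz] at key
  refine (key.mul_left ((2 * Real.pi * Complex.I) ^ d)⁻¹).of_eq (fun m => ?_) ?_
  · ring
  · field_simp

theorem extendZero_apply {d : ℕ} (f : unitBall d → ℂ) (z : unitBall d) :
    extendZero f (z : Fin d → ℂ) = f z :=
  Subtype.val_injective.extend_apply f 0 z

/-- A small polydisc at `0` supplies the coefficients. For any `z` in the ball, the slice `ζ ↦ f (ζ
z)` is holomorphic on a disc of radius `R > 1`; near `0` its Taylor coefficients must be the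
homogeneous polynomials at `z`. The Taylor series at `ζ = 1` then gives `f z`. -/
theorem Holomorphic.exists_hasHomogeneousExpansion {d : ℕ} {f : unitBall d → ℂ}
    (hf : Holomorphic f) : ∃ a, HasHomogeneousExpansion f a := by
  have h0 : (0 : Fin d → ℂ) ∈ unitBall d := by simp [unitBall, sqNorm]
  obtain ⟨r, hr, hball⟩ := Metric.nhds_basis_closedBall.mem_iff.1
    ((isOpen_unitBall d).mem_nhds h0)
  obtain ⟨a, ha⟩ := exists_hasSum_monomial_of_differentiableOn_closedBall hr (hf.mono hball)
  refine ⟨a, fun z => ?_⟩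
  obtain ⟨R, hR, hRz⟩ := exists_smul_mem_unitBall z
  have hφ : DifferentiableOn ℂ (fun ζ : ℂ => extendZero f (ζ • (z : Fin d → ℂ)))
      (Metric.ball 0 R) :=
    hf.comp (Differentiable.differentiableOn (by fun_prop)) fun ζ hζ =>
      hRz ζ (mem_ball_zero_iff.1 hζ)
  have htaylor := Complex.hasSum_taylorSeries_on_ball hφ
  have h1 : HasFPowerSeriesAt (fun ζ : ℂ => extendZero f (ζ • (z : Fin d → ℂ)))
      (FormalMultilinearSeries.ofScalars ℂ fun k => (k.factorial : ℂ)⁻¹ *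
        iteratedDeriv k (fun ζ : ℂ => extendZero f (ζ • (z : Fin d → ℂ))) 0) 0 := by
    rw [hasFPowerSeriesAt_iff]
    filter_upwards [Metric.ball_mem_nhds (0 : ℂ) (one_pos.trans hR)] with ζ hζ
    refine (htaylor hζ).of_eq (fun k => ?_) ?_
    · simp [FormalMultilinearSeries.coeff_ofScalars]
      ring
    · simp
  have h2 : HasFPowerSeriesAt (fun ζ : ℂ => extendZero f (ζ • (z : Fin d → ℂ)))
      (FormalMultilinearSeries.ofScalars ℂ fun k =>
        ∑ m ∈ degreeSet d k, a m * monomialFun m z) 0 := by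
    rw [hasFPowerSeriesAt_iff]
    have hsmall : ∀ᶠ ζ : ℂ in nhds 0, ∀ j, ‖(ζ • (z : Fin d → ℂ)) j‖ < r := by
      refine Filter.eventually_all.2 fun j => ?_
      have : Filter.Tendsto (fun ζ : ℂ => ‖(ζ • (z : Fin d → ℂ)) j‖) (nhds 0) (nhds 0) := by
        have hc : Continuous fun ζ : ℂ => ‖(ζ • (z : Fin d → ℂ)) j‖ := by
          simp only [Pi.smul_apply]; fun_prop
        simpa using hc.tendsto 0
      exact this.eventually_lt_const hr
    filter_upwards [hsmall, Metric.ball_mem_nhds (0 : ℂ) (one_pos.trans hR)] with ζ hζ hζR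
    have hm := hRz ζ (mem_ball_zero_iff.1 hζR)
    refine (ha _ hζ).sum_degreeSet.of_eq (fun k => ?_) ?_
    · rw [FormalMultilinearSeries.coeff_ofScalars, smul_eq_mul, mul_comm]
      exact (sum_degreeSet_smul a ζ z hm).symm
    · rw [zero_add]
  have heq := h1.eq_formalMultilinearSeries h2
  have h3 := htaylor (z := 1) (by simpa using hR)
  simp only [one_smul] at h3
  rw [extendZero_apply] at h3
  refine h3.of_eq (fun k => ?_) rfl
  have h4 := congrArg (fun p => p.coeff k) heq
  simp only [FormalMultilinearSeries.coeff_ofScalars] at h4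
  rw [← h4]
  simp

/-! ### Termwise differentiation and the number operator -/

/-- `f` is the pointwise (absolutely convergent) sum of the power series with coefficients `a`. -/
def HasMonomialExpansion {d : ℕ} (f : unitBall d → ℂ) (a : (Fin d → ℕ) → ℂ) : Prop :=
  ∀ z, HasSum (fun m => a m * monomialFun m z) (f z)

theorem HasMonomialExpansion.hasHomogeneousExpansion {d : ℕ} {f : unitBall d → ℂ}
    {a : (Fin d → ℕ) → ℂ} (h : HasMonomialExpansion f a) : HasHomogeneousExpansion f a :=
  fun z => (h z).sum_degreeSet

/-- The Fréchet derivative of the monomial `z^m`. -/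
noncomputable def monomialDeriv {d : ℕ} (m : Fin d → ℕ) (z : Fin d → ℂ) : (Fin d → ℂ) →L[ℂ] ℂ :=
  ∑ i, (∏ j ∈ Finset.univ.erase i, z j ^ m j) •
    ((m i * z i ^ (m i - 1)) • ContinuousLinearMap.proj (R := ℂ) (φ := fun _ : Fin d => ℂ) i)

theorem hasFDerivAt_monomial {d : ℕ} (m : Fin d → ℕ) (z : Fin d → ℂ) :
    HasFDerivAt (fun z : Fin d → ℂ => ∏ j, z j ^ m j) (monomialDeriv m z) z :=
  HasFDerivAt.finsetProd fun i _ => by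
    have h : HasFDerivAt (fun w : Fin d → ℂ => w i)
      (ContinuousLinearMap.proj (R := ℂ) (φ := fun _ : Fin d => ℂ) i) z := hasFDerivAt_apply i z
    simpa using h.pow (m i)

/-- Euler's identity for homogeneous polynomials. The truncated `m i - 1` is harmless, as the factor
`m i` vanishes when `m i = 0`. -/
theorem monomialDeriv_apply_self {d : ℕ} (m : Fin d → ℕ) (z : Fin d → ℂ) :
    monomialDeriv m z z = (∑ j, (m j : ℂ)) * ∏ j, z j ^ m j := by
  rw [monomialDeriv, sum_apply, Finset.sum_mul]
  refine Finset.sum_congr rfl fun i _ => ?_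
  rw [← Finset.mul_prod_erase _ _ (Finset.mem_univ i)]
  simp only [smul_apply, ContinuousLinearMap.proj_apply, smul_eq_mul]
  rcases Nat.eq_zero_or_pos (m i) with h | h
  · simp [h]
  · rw [← Nat.sub_add_cancel h, pow_succ]
    simp
    ring

/-- Replacing `R i ^ (m i - 1)` by `R i ^ (m i) / ρ` gives a bound in terms of the monomial itself,
uniform over the polydisc. -/
theorem norm_monomialDeriv_le {d : ℕ} (m : Fin d → ℕ) {z : Fin d → ℂ} {R : Fin d → ℝ} {ρ : ℝ}
    (hρ : 0 < ρ) (hR : ∀ j, ρ ≤ R j) (hz : ∀ j, ‖z j‖ ≤ R j) :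
    ‖monomialDeriv m z‖ ≤ (∑ j, (m j : ℝ)) * (∏ j, R j ^ m j) / ρ := by
  have hR0 (j : Fin d) : 0 < R j := hρ.trans_le (hR j)
  rw [monomialDeriv, Finset.sum_mul, Finset.sum_div]
  refine (norm_sum_le _ _).trans (Finset.sum_le_sum fun i _ => ?_)
  have hproj : ‖ContinuousLinearMap.proj (R := ℂ) (φ := fun _ : Fin d => ℂ) i‖ ≤ 1 :=
    ContinuousLinearMap.opNorm_le_bound _ zero_le_one fun x => by simpa using norm_le_pi_norm x i
  rw [norm_smul, norm_smul, norm_prod, norm_mul, norm_pow, Complex.norm_natCast]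
  simp only [norm_pow]
  calc (∏ j ∈ Finset.univ.erase i, ‖z j‖ ^ m j) * (m i * ‖z i‖ ^ (m i - 1) *
        ‖ContinuousLinearMap.proj (R := ℂ) (φ := fun _ : Fin d => ℂ) i‖)
      ≤ (∏ j ∈ Finset.univ.erase i, R j ^ m j) * (m i * R i ^ (m i - 1) * 1) := by
        gcongr with j hj
        · exact Finset.prod_nonneg fun j _ => pow_nonneg (hR0 j).le _
        · exact hz j
        · exact mul_nonneg (by positivity) (pow_nonneg (hR0 i).le _)
        · exact hz i
    _ ≤ m i * (∏ j, R j ^ m j) / ρ := by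
        rw [← Finset.mul_prod_erase _ _ (Finset.mem_univ i), le_div_iff₀ hρ]
        have hP : 0 ≤ ∏ j ∈ Finset.univ.erase i, R j ^ m j :=
          Finset.prod_nonneg fun j _ => pow_nonneg (hR0 j).le _
        rcases Nat.eq_zero_or_pos (m i) with h | h
        · simp [h]
        · have : R i ^ m i = R i ^ (m i - 1) * R i := by
            rw [← pow_succ, Nat.sub_add_cancel h]
          rw [this]
          calc _ = (m i * (∏ j ∈ Finset.univ.erase i, R j ^ m j) * R i ^ (m i - 1)) * ρ := by ring
            _ ≤ (m i * (∏ j ∈ Finset.univ.erase i, R j ^ m j) * R i ^ (m i - 1)) * R i := by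
              have := pow_nonneg (hR0 i).le (m i - 1)
              gcongr
              exact hR i
            _ = _ := by ring

theorem exists_polyradius {d : ℕ} (z : unitBall d) : ∃ (ρ t : ℝ) (R : Fin d → ℝ),
    0 < ρ ∧ 1 < t ∧ (∀ j, ρ ≤ R j) ∧ (∀ j, ‖(z : Fin d → ℂ) j‖ < R j) ∧
    (fun j => ((t * R j : ℝ) : ℂ)) ∈ unitBall d := by
  have h1 := one_sub_sqNorm_pos z
  -- Adding `δ` to each `|z_j|²` raises the sum by `d δ < (d + 1) δ = 1 - |z|²`, so the point with
  -- coordinates `R j` stays in the ball, with room for a dilation by `t > 1`.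
  set δ : ℝ := (1 - sqNorm (z : Fin d → ℂ)) / (d + 1) with hδ
  have hδ0 : 0 < δ := by positivity
  let R : Fin d → ℝ := fun j => √(‖(z : Fin d → ℂ) j‖ ^ 2 + δ)
  have hRsq (j : Fin d) : R j ^ 2 = ‖(z : Fin d → ℂ) j‖ ^ 2 + δ := Real.sq_sqrt (by positivity)
  have hRball : (fun j => (R j : ℂ)) ∈ unitBall d := by
    have : δ * (d + 1) = 1 - sqNorm (z : Fin d → ℂ) := by rw [hδ]; field_simp
    simp only [unitBall, Set.mem_ofPred_eq, sqNorm, Complex.norm_real, Real.norm_eq_abs, sq_abs, hRsq,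
      Finset.sum_add_distrib, Finset.sum_const, Finset.card_univ, Fintype.card_fin, nsmul_eq_mul]
    change sqNorm (z : Fin d → ℂ) + d * δ < 1
    nlinarith
  obtain ⟨r, hr, hball⟩ := exists_smul_mem_unitBall ⟨_, hRball⟩
  obtain ⟨t, ht1, htr⟩ := exists_between hr
  refine ⟨√δ, t, R, Real.sqrt_pos.2 hδ0, ht1, fun j => Real.sqrt_le_sqrt (by simp), fun j =>
    Real.lt_sqrt_of_sq_lt (by simpa using hδ0), ?_⟩
  convert hball t (by simpa [abs_of_pos (one_pos.trans ht1)] using htr) using 1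
  funext j
  simp

/-- The series converges absolutely at the point `t R`, and the surplus `t^|m|` absorbs the factor
`|m|` coming from differentiation. This majorizes the derivatives on the polydisc of radii `R`. -/
theorem HasMonomialExpansion.hasFDerivAt {d : ℕ} {f : unitBall d → ℂ} {a : (Fin d → ℕ) → ℂ}
    (h : HasMonomialExpansion f a) (z : unitBall d) :
    ∃ f' : (Fin d → ℂ) →L[ℂ] ℂ, HasFDerivAt (extendZero f) f' (z : Fin d → ℂ) ∧
      HasSum (fun m => a m • monomialDeriv m (z : Fin d → ℂ)) f' := by
  obtain ⟨ρ, t, R, hρ, ht, hρR, hzR, htR⟩ := exists_polyradius z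
  have hR0 (j : Fin d) : 0 < R j := hρ.trans_le (hρR j)
  have ht0 : 0 < t - 1 := sub_pos.2 ht
  let s : Set (Fin d → ℂ) := Set.univ.pi fun j => Metric.ball 0 (R j)
  have hs : IsOpen s := isOpen_set_pi Set.finite_univ fun j _ => Metric.isOpen_ball
  have hconv : Convex ℝ s := convex_pi fun j _ => convex_ball _ _
  have hmem {w : Fin d → ℂ} (hw : w ∈ s) (j : Fin d) : ‖w j‖ < R j :=
    mem_ball_zero_iff.1 (hw j trivial)
  have hzs : (z : Fin d → ℂ) ∈ s := fun j _ => mem_ball_zero_iff.2 (hzR j)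
  have hsub : s ⊆ unitBall d := fun w hw => by
    refine lt_of_le_of_lt (b := sqNorm fun j => ((t * R j : ℝ) : ℂ))
      (Finset.sum_le_sum fun j _ => ?_) htR
    rw [Complex.norm_real, Real.norm_of_nonneg (by have := hR0 j; positivity)]
    have := hmem hw j
    gcongr
    nlinarith [hR0 j]
  let u : (Fin d → ℕ) → ℝ := fun m => ‖a m‖ * ((∑ j, (m j : ℝ)) * (∏ j, R j ^ m j) / ρ)
  have hu : Summable u := by
    have h1 := ((h ⟨_, htR⟩).summable.norm).mul_left (((t - 1) * ρ)⁻¹)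
    refine Summable.of_nonneg_of_le (fun m => ?_) (fun m => ?_) h1
    · have := Finset.prod_nonneg fun j (_ : j ∈ Finset.univ) => pow_nonneg (hR0 j).le (m j)
      positivity
    · have hP := Finset.prod_nonneg fun j (_ : j ∈ Finset.univ) => pow_nonneg (hR0 j).le (m j)
      have h2 : ‖a m * monomialFun m ⟨_, htR⟩‖ =
          ‖a m‖ * (t ^ (∑ j, m j) * ∏ j, R j ^ m j) := by
        simp only [monomialFun, norm_mul, norm_prod, norm_pow, Complex.norm_real, Real.norm_eq_abs,
          abs_of_pos (one_pos.trans ht), abs_of_pos (hR0 _), mul_pow, Finset.prod_mul_distrib,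
          Finset.prod_pow_eq_pow_sum]
      -- Bernoulli's inequality for `t = 1 + (t - 1)`.
      have h3 : (∑ j, (m j : ℝ)) * (t - 1) ≤ t ^ (∑ j, m j) := by
        have := one_add_mul_le_pow (a := t - 1) (by linarith) (∑ j, m j)
        push_cast at this
        rw [add_sub_cancel] at this
        linarith
      rw [h2]
      calc u m = ((t - 1) * ρ)⁻¹ * (‖a m‖ * (((∑ j, (m j : ℝ)) * (t - 1)) *
            ∏ j, R j ^ m j)) := by simp only [u]; field_simp
        _ ≤ _ := by gcongr
  have hbound (m : Fin d → ℕ) (w : Fin d → ℂ) (hw : w ∈ s) : ‖a m • monomialDeriv m w‖ ≤ u m := by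
    rw [norm_smul]
    exact mul_le_mul_of_nonneg_left (norm_monomialDeriv_le m hρ hρR fun j => (hmem hw j).le)
      (norm_nonneg _)
  have hterm (m : Fin d → ℕ) (w : Fin d → ℂ) (_ : w ∈ s) :
      HasFDerivAt (fun w : Fin d → ℂ => a m * ∏ j, w j ^ m j) (a m • monomialDeriv m w) w :=
    (hasFDerivAt_monomial m w).const_mul (a m)
  have hd := hasFDerivAt_tsum_of_isPreconnected hu hs hconv.isPreconnected hterm
    hbound hzs (h z).summable hzs
  refine ⟨_, hd.congr_of_eventuallyEq ?_,
    (Summable.of_norm_bounded hu fun m => hbound m _ hzs).hasSum⟩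
  filter_upwards [hs.mem_nhds hzs] with w hw
  exact (extendZero_apply f ⟨w, hsub hw⟩).trans (h ⟨w, hsub hw⟩).tsum_eq.symm

theorem HasMonomialExpansion.holomorphic {d : ℕ} {f : unitBall d → ℂ} {a : (Fin d → ℕ) → ℂ}
    (h : HasMonomialExpansion f a) : Holomorphic f := fun z hz =>
  let ⟨_, hf', _⟩ := h.hasFDerivAt ⟨z, hz⟩
  hf'.differentiableAt.differentiableWithinAt

theorem numberOp_eq_fderiv_apply {d : ℕ} (f : unitBall d → ℂ) (z : unitBall d) :
    numberOp f z = fderiv ℂ (extendZero f) (z : Fin d → ℂ) (z : Fin d → ℂ) := by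
  have h := congrArg (fderiv ℂ (extendZero f) (z : Fin d → ℂ))
    (Finset.univ_sum_single (z : Fin d → ℂ))
  rw [← h, map_sum]
  refine Finset.sum_congr rfl fun j _ => ?_
  rw [← smul_eq_mul, ← map_smul, ← Pi.single_smul', smul_eq_mul, mul_one]

theorem HasMonomialExpansion.numberOp {d : ℕ} {f : unitBall d → ℂ} {a : (Fin d → ℕ) → ℂ}
    (h : HasMonomialExpansion f a) :
    HasMonomialExpansion (numberOp f) fun m => (∑ j, (m j : ℂ)) * a m := fun z => by
  obtain ⟨f', hf', hsum⟩ := h.hasFDerivAt z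
  rw [numberOp_eq_fderiv_apply, hf'.fderiv]
  refine (((ContinuousLinearMap.apply ℂ ℂ) (z : Fin d → ℂ)).hasSum hsum).of_eq (fun m => ?_) rfl
  simp only [ContinuousLinearMap.apply_apply, smul_apply,
    monomialDeriv_apply_self, smul_eq_mul, monomialFun]
  ring

theorem HasMonomialExpansion.numberOp_iterate {d : ℕ} {f : unitBall d → ℂ} {a : (Fin d → ℕ) → ℂ}
    (h : HasMonomialExpansion f a) (k : ℕ) :
    HasMonomialExpansion (_root_.numberOp^[k] f) fun m => (∑ j, (m j : ℂ)) ^ k * a m := by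
  induction k with
  | zero => simpa using h
  | succ k ih =>
    rw [Function.iterate_succ_apply']
    simpa only [pow_succ', mul_assoc] using ih.numberOp

theorem HasMonomialExpansion.shiftOp {d : ℕ} {f : unitBall d → ℂ} {a : (Fin d → ℕ) → ℂ}
    (h : HasMonomialExpansion f a) (c : ℝ) :
    HasMonomialExpansion (shiftOp c f) fun m => ((1 + (∑ j, (m j : ℝ)) / c : ℝ) : ℂ) * a m :=
  fun z => ((h z).add ((h.numberOp z).div_const (c : ℂ))).of_eq
    (fun m => by push_cast; ring) rfl

/-- The eigenvalue of `shiftProd c k` on homogeneous polynomials of degree `x`. -/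
noncomputable def shiftFactor (c : ℝ) (k : ℕ) (x : ℝ) : ℝ := ∏ j ∈ Finset.range k, (1 + x / (c + j))

theorem HasMonomialExpansion.shiftProd {d : ℕ} {f : unitBall d → ℂ} {a : (Fin d → ℕ) → ℂ}
    (h : HasMonomialExpansion f a) (c : ℝ) (k : ℕ) :
    HasMonomialExpansion (shiftProd c k f) fun m => (shiftFactor c k (∑ j, (m j : ℝ)) : ℂ) * a m := by
  induction k generalizing f a with
  | zero => simpa [shiftFactor, _root_.shiftProd] using h
  | succ k ih =>
    have := ih (h.shiftOp (c + k))
    simpa only [shiftFactor, _root_.shiftProd, Finset.prod_range_succ, Complex.ofReal_mul, mul_assoc]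
      using this

/-! ### The binomial series in several variables -/

theorem inv_monomialWeight {d k : ℕ} {s : ℝ} {m : Fin d → ℕ} (hm : m ∈ degreeSet d k) :
    (monomialWeight s m)⁻¹ = Real.Gamma (s + k) / Real.Gamma s / k.factorial *
      Nat.multinomial Finset.univ m := by
  have h := Nat.multinomial_spec Finset.univ m
  rw [mem_degreeSet.1 hm] at h
  have hm' : (∑ j, (m j : ℝ)) = k := by exact_mod_cast mem_degreeSet.1 hm
  have hf : (∏ j, ((m j).factorial : ℝ)) ≠ 0 :=
    Finset.prod_ne_zero_iff.2 fun j _ => by positivity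
  rw [monomialWeight, hm', ← h]
  push_cast
  have : (Nat.multinomial Finset.univ m : ℝ) ≠ 0 := by
    intro h0
    have : Nat.multinomial Finset.univ m = 0 := by exact_mod_cast h0
    rw [this, mul_zero] at h
    exact k.factorial_ne_zero h.symm
  rw [inv_div]
  field_simp

/-- The multinomial theorem. The real case gives absolute convergence, the complex case the value of
the kernel. -/
theorem sum_degreeSet_div_monomialWeight {𝕜 : Type*} [RCLike 𝕜] {d : ℕ} (s : ℝ) (x : Fin d → 𝕜)
    (k : ℕ) : ∑ m ∈ degreeSet d k, ((monomialWeight s m)⁻¹ : ℝ) * ∏ j, x j ^ m j =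
      ((Real.Gamma (s + k) / Real.Gamma s / k.factorial : ℝ) : 𝕜) * (∑ j, x j) ^ k := by
  rw [Finset.sum_pow_eq_sum_piAntidiag, Finset.mul_sum]
  refine Finset.sum_congr rfl fun m hm => ?_
  rw [inv_monomialWeight hm]
  push_cast
  ring

theorem Ring.choose_add_sub_one_eq_Gamma {s : ℝ} (hs : 0 < s) (k : ℕ) :
    Ring.choose ((s : ℂ) + k - 1) k =
      ((Real.Gamma (s + k) / Real.Gamma s / k.factorial : ℝ) : ℂ) := by
  have h1 := Complex.Gamma_add_nat_div_Gamma_eq (n := k) (s : ℂ) fun j h => by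
    have h2 := congrArg Complex.re h
    simp only [Complex.ofReal_re, Complex.neg_re, Complex.natCast_re] at h2
    have : (0 : ℝ) ≤ j := j.cast_nonneg
    linarith
  have h2 := Ring.factorial_nsmul_multichoose_eq_ascPochhammer (s : ℂ) k
  rw [Ring.multichoose_eq, Polynomial.ascPochhammer_smeval_eq_eval, ← h1, nsmul_eq_mul] at h2
  have h3 : (k.factorial : ℂ) ≠ 0 := by exact_mod_cast k.factorial_ne_zero
  have h4 : ((s : ℂ) + k) = ((s + k : ℝ) : ℂ) := by push_cast; rfl
  push_cast
  rw [eq_div_iff h3, mul_comm, h2, h4, Complex.Gamma_ofReal, Complex.Gamma_ofReal]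

theorem hasSum_binomial_Gamma {s : ℝ} (hs : 0 < s) {x : ℂ} (hx : ‖x‖ < 1) :
    HasSum (fun k : ℕ => ((Real.Gamma (s + k) / Real.Gamma s / k.factorial : ℝ) : ℂ) * x ^ k)
      (1 / (1 - x) ^ (s : ℂ)) := by
  have h := (Complex.one_div_one_sub_cpow_hasFPowerSeriesOnBall_zero (s : ℂ)).hasSum (y := x)
    (by rw [Metric.mem_eball, edist_zero_right, ← ofReal_norm]; exact ENNReal.ofReal_lt_one.2 hx)
  rw [zero_add] at h
  refine h.of_eq (fun k => ?_) rfl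
  rw [← Ring.choose_add_sub_one_eq_Gamma hs]
  simp [mul_comm]

/-- Nonnegative terms may be grouped by degree; the result is the binomial series at `∑ ‖x j‖ < 1`.
-/
theorem summable_norm_div_monomialWeight {d : ℕ} {s : ℝ} (hs : 0 < s) {x : Fin d → ℂ}
    (hx : ∑ j, ‖x j‖ < 1) :
    Summable fun m : Fin d → ℕ => (monomialWeight s m)⁻¹ * ∏ j, ‖x j‖ ^ m j := by
  have ht : ‖((∑ j, ‖x j‖ : ℝ) : ℂ)‖ < 1 := by
    rwa [Complex.norm_real, Real.norm_of_nonneg (Finset.sum_nonneg fun _ _ => norm_nonneg _)]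
  have h1 : Summable fun k : ℕ => Real.Gamma (s + k) / Real.Gamma s / k.factorial *
      (∑ j, ‖x j‖) ^ k := by
    have := (hasSum_binomial_Gamma hs ht).summable
    exact_mod_cast this
  have hG (k : ℕ) : 0 ≤ Real.Gamma (s + k) / Real.Gamma s / k.factorial := by
    have := (Real.Gamma_pos_of_pos hs).le
    have := (Real.Gamma_pos_of_pos (by positivity : 0 < s + k)).le
    positivity
  have hnn (m : Fin d → ℕ) : 0 ≤ (monomialWeight s m)⁻¹ * ∏ j, ‖x j‖ ^ m j :=
    mul_nonneg (inv_nonneg.2 (monomialWeight_pos hs m).le)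
      (Finset.prod_nonneg fun _ _ => by positivity)
  have h2 : ∑' m : Fin d → ℕ, ENNReal.ofReal ((monomialWeight s m)⁻¹ * ∏ j, ‖x j‖ ^ m j) ≠ ⊤ := by
    rw [← ENNReal.tsum_sum_degreeSet]
    have h3 (k : ℕ) : ∑ m ∈ degreeSet d k,
        ENNReal.ofReal ((monomialWeight s m)⁻¹ * ∏ j, ‖x j‖ ^ m j) =
        ENNReal.ofReal (Real.Gamma (s + k) / Real.Gamma s / k.factorial * (∑ j, ‖x j‖) ^ k) := by
      rw [← ENNReal.ofReal_sum_of_nonneg fun m _ => hnn m]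
      congr 1
      exact sum_degreeSet_div_monomialWeight (𝕜 := ℝ) s (fun j => ‖x j‖) k
    simp_rw [h3]
    exact h1.tsum_ofReal_ne_top
  refine (ENNReal.summable_toReal h2).congr fun m => ?_
  rw [ENNReal.toReal_ofReal (hnn m)]

theorem hasSum_div_monomialWeight {d : ℕ} {s : ℝ} (hs : 0 < s) {x : Fin d → ℂ}
    (hx : ∑ j, ‖x j‖ < 1) :
    HasSum (fun m : Fin d → ℕ => ((monomialWeight s m)⁻¹ : ℝ) * ∏ j, x j ^ m j)
      (1 / (1 - ∑ j, x j) ^ (s : ℂ)) := by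
  have hsum : Summable fun m : Fin d → ℕ =>
      (((monomialWeight s m)⁻¹ : ℝ) : ℂ) * ∏ j, x j ^ m j := by
    refine Summable.of_norm ((summable_norm_div_monomialWeight hs hx).congr fun m => ?_)
    rw [norm_mul, Complex.norm_real, Real.norm_of_nonneg (inv_nonneg.2 (monomialWeight_pos hs m).le),
      norm_prod]
    simp only [norm_pow]
  have h1 := hsum.hasSum.sum_degreeSet
  have h2 := hasSum_binomial_Gamma hs (x := ∑ j, x j) ((norm_sum_le _ _).trans_lt hx)
  have h3 := (h1.of_eq (fun k => (sum_degreeSet_div_monomialWeight (𝕜 := ℂ) s x k).symm) rfl).unique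
    h2
  rw [← h3]
  exact hsum.hasSum

/-! ### Square-summable coefficients and Bergman spaces -/

theorem summable_norm_monomialFun_sq_div {d : ℕ} {s : ℝ} (hs : 0 < s) (z : unitBall d) :
    Summable fun m : Fin d → ℕ => ‖monomialFun m z‖ ^ 2 / monomialWeight s m := by
  have h := summable_norm_div_monomialWeight hs
    (x := fun j => ((‖(z : Fin d → ℂ) j‖ ^ 2 : ℝ) : ℂ)) (by
      have hz : sqNorm (z : Fin d → ℂ) < 1 := z.2
      simpa [sqNorm] using hz)
  refine h.congr fun m => ?_
  rw [div_eq_inv_mul, monomialFun, norm_prod, ← Finset.prod_pow]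
  simp [← pow_mul, mul_comm]

/-- `2xy ≤ x² + y²` with `x = |a_m| √w` and `y = |z^m| / √w`; the squares of the `y` sum to the
kernel on the diagonal. -/
theorem summable_mul_monomialFun {d : ℕ} {s : ℝ} (hs : 0 < s) {a : (Fin d → ℕ) → ℂ}
    (ha : Summable fun m => ‖a m‖ ^ 2 * monomialWeight s m) (z : unitBall d) :
    Summable fun m => a m * monomialFun m z := by
  refine Summable.of_norm_bounded (ha.add (summable_norm_monomialFun_sq_div hs z)) fun m => ?_
  have hw := monomialWeight_pos hs m
  have h1 : ‖a m * monomialFun m z‖ =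
      (‖a m‖ * √(monomialWeight s m)) * (‖monomialFun m z‖ / √(monomialWeight s m)) := by
    rw [norm_mul]
    have := (Real.sqrt_pos.2 hw).ne'
    field_simp
  have h2 := two_mul_le_add_sq (‖a m‖ * √(monomialWeight s m))
    (‖monomialFun m z‖ / √(monomialWeight s m))
  rw [mul_pow, div_pow, Real.sq_sqrt hw.le] at h2
  have h3 : 0 ≤ ‖a m * monomialFun m z‖ := norm_nonneg _
  linarith

theorem HasHomogeneousExpansion.hasMonomialExpansion {d : ℕ} {s : ℝ} (hs : 0 < s)
    {f : unitBall d → ℂ} {a : (Fin d → ℕ) → ℂ} (h : HasHomogeneousExpansion f a)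
    (ha : Summable fun m => ‖a m‖ ^ 2 * monomialWeight s m) : HasMonomialExpansion f a :=
  fun z => by
  have hsum := (summable_mul_monomialFun hs ha z).hasSum
  rwa [hsum.sum_degreeSet.unique (h z)] at hsum

theorem hasMonomialExpansion_tsum {d : ℕ} {s : ℝ} (hs : 0 < s) {a : (Fin d → ℕ) → ℂ}
    (ha : Summable fun m => ‖a m‖ ^ 2 * monomialWeight s m) :
    HasMonomialExpansion (fun z => ∑' m, a m * monomialFun m z) a :=
  fun z => (summable_mul_monomialFun hs ha z).hasSum

theorem HasHomogeneousExpansion.memLp_iff {d : ℕ} {σ : ℝ} (hσ : (d : ℝ) < σ)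
    {f : unitBall d → ℂ} {a : (Fin d → ℕ) → ℂ} (h : HasHomogeneousExpansion f a) :
    MemLp f 2 (bergmanMeasure d σ) ↔ Summable fun m => ‖a m‖ ^ 2 * monomialWeight σ m := by
  have hnn (m : Fin d → ℕ) : 0 ≤ ‖a m‖ ^ 2 * monomialWeight σ m :=
    mul_nonneg (by positivity) (monomialWeight_pos (lt_of_le_of_lt d.cast_nonneg hσ) m).le
  rw [MemLp, and_iff_right h.measurable.aestronglyMeasurable,
    eLpNorm_lt_top_iff_lintegral_rpow_enorm_lt_top two_ne_zero ENNReal.ofNat_ne_top]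
  simp only [ENNReal.toReal_ofNat, ENNReal.rpow_ofNat]
  rw [h.lintegral_enorm_sq hσ]
  refine ⟨fun h' => ?_, fun h' => h'.tsum_ofReal_lt_top⟩
  refine (ENNReal.summable_toReal h'.ne).congr fun m => ?_
  rw [ENNReal.toReal_ofReal (hnn m)]

theorem HasHomogeneousExpansion.hasSum_norm_sq {d : ℕ} {σ : ℝ} (hσ : (d : ℝ) < σ)
    {f : unitBall d → ℂ} {a : (Fin d → ℕ) → ℂ} (h : HasHomogeneousExpansion f a)
    (hf : MemLp f 2 (bergmanMeasure d σ)) :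
    HasSum (fun m => ‖a m‖ ^ 2 * monomialWeight σ m) (∫ z, ‖f z‖ ^ 2 ∂(bergmanMeasure d σ)) := by
  have hs := (h.memLp_iff hσ).1 hf
  rw [integral_norm_sq_eq_toReal_lintegral hf.1, h.lintegral_enorm_sq hσ,
    ← ENNReal.ofReal_tsum_of_nonneg (fun m => mul_nonneg (by positivity)
      (monomialWeight_pos (lt_of_le_of_lt d.cast_nonneg hσ) m).le) hs, ENNReal.toReal_ofReal
      (tsum_nonneg fun m => mul_nonneg (by positivity)
      (monomialWeight_pos (lt_of_le_of_lt d.cast_nonneg hσ) m).le)]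
  exact hs.hasSum

theorem HasHomogeneousExpansion.add_const_mul {d : ℕ} {f g : unitBall d → ℂ}
    {a b : (Fin d → ℕ) → ℂ} (hf : HasHomogeneousExpansion f a) (hg : HasHomogeneousExpansion g b)
    (c : ℂ) : HasHomogeneousExpansion (fun z => f z + c * g z) fun m => a m + c * b m := fun z => by
  refine ((hf z).add ((hg z).mul_left c)).of_eq (fun k => ?_) rfl
  rw [Finset.mul_sum, ← Finset.sum_add_distrib]
  exact Finset.sum_congr rfl fun m _ => by ring

theorem Complex.conj_mul_eq_polarization (x y : ℂ) :
    conj x * y = (((‖x + 1 * y‖ ^ 2 : ℝ) : ℂ) - ((‖x + -1 * y‖ ^ 2 : ℝ) : ℂ) +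
      (((‖x + -Complex.I * y‖ ^ 2 : ℝ) : ℂ) - ((‖x + Complex.I * y‖ ^ 2 : ℝ) : ℂ)) * Complex.I) / 4 := by
  have h := inner_eq_sum_norm_sq_div_four (𝕜 := ℂ) x y
  rw [RCLike.inner_apply, mul_comm] at h
  rw [h]
  simp [sub_eq_add_neg]

/-- Polarization of the norm formula, applied to `f + c g` for `c = ±1, ±i`. -/
theorem HasHomogeneousExpansion.hasSum_bergmanInner {d : ℕ} {σ : ℝ} (hσ : (d : ℝ) < σ)
    {f g : unitBall d → ℂ} {a b : (Fin d → ℕ) → ℂ} (hf : HasHomogeneousExpansion f a)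
    (hg : HasHomogeneousExpansion g b) (hf2 : MemLp f 2 (bergmanMeasure d σ))
    (hg2 : MemLp g 2 (bergmanMeasure d σ)) :
    HasSum (fun m => conj (a m) * b m * monomialWeight σ m) (bergmanInner σ f g) := by
  have hmem (c : ℂ) : MemLp (fun z => f z + c * g z) 2 (bergmanMeasure d σ) :=
    hf2.add (hg2.const_mul c)
  have hint (c : ℂ) : Integrable (fun z => ((‖f z + c * g z‖ ^ 2 : ℝ) : ℂ)) (bergmanMeasure d σ) :=
    ((hmem c).integrable_norm_pow two_ne_zero).ofReal
  have hS (c : ℂ) : HasSum (fun m => ((‖a m + c * b m‖ ^ 2 * monomialWeight σ m : ℝ) : ℂ))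
      (∫ z, ((‖f z + c * g z‖ ^ 2 : ℝ) : ℂ) ∂(bergmanMeasure d σ)) := by
    rw [integral_complex_ofReal]
    exact Complex.hasSum_ofReal.2 ((hf.add_const_mul hg c).hasSum_norm_sq hσ (hmem c))
  refine ((((hS 1).sub (hS (-1))).add (((hS (-Complex.I)).sub (hS Complex.I)).mul_right
    Complex.I)).div_const 4).of_eq (fun m => ?_) ?_
  · rw [Complex.conj_mul_eq_polarization]
    push_cast
    ring
  · unfold bergmanInner
    simp_rw [Complex.conj_mul_eq_polarization]
    have hsub (c e : ℂ) : Integrable (fun z => ((‖f z + c * g z‖ ^ 2 : ℝ) : ℂ) -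
        ((‖f z + e * g z‖ ^ 2 : ℝ) : ℂ)) (bergmanMeasure d σ) := (hint c).sub (hint e)
    rw [integral_div, integral_add (hsub _ _) ((hsub _ _).mul_const _),
      integral_mul_const, integral_sub (hint _) (hint _), integral_sub (hint _) (hint _)]

theorem MemBergman.exists_expansion {d : ℕ} {σ : ℝ} (hσ : (d : ℝ) < σ) {f : unitBall d → ℂ}
    (hf : MemBergman σ f) : ∃ a, HasMonomialExpansion f a ∧
      Summable fun m => ‖a m‖ ^ 2 * monomialWeight σ m := by
  obtain ⟨a, ha⟩ := hf.1.exists_hasHomogeneousExpansion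
  have hs := (ha.memLp_iff hσ).1 hf.2
  exact ⟨a, ha.hasMonomialExpansion (lt_of_le_of_lt d.cast_nonneg hσ) hs, hs⟩

theorem HasMonomialExpansion.memBergman_iff {d : ℕ} {σ : ℝ} (hσ : (d : ℝ) < σ)
    {f : unitBall d → ℂ} {a : (Fin d → ℕ) → ℂ} (h : HasMonomialExpansion f a) :
    MemBergman σ f ↔ Summable fun m => ‖a m‖ ^ 2 * monomialWeight σ m := by
  rw [MemBergman, and_iff_right h.holomorphic, h.hasHomogeneousExpansion.memLp_iff hσ]

/-! ### Eigenvalues of the operators `A` and `B` -/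

theorem shiftFactor_pos {c : ℝ} (hc : 0 < c) (k : ℕ) {x : ℝ} (hx : 0 ≤ x) :
    0 < shiftFactor c k x :=
  Finset.prod_pos fun j _ => by positivity

theorem shiftFactor_le {c : ℝ} (hc : 0 < c) (k : ℕ) {x : ℝ} (hx : 0 ≤ x) :
    shiftFactor c k x ≤ ((1 + 1 / c) * (1 + x)) ^ k := by
  rw [← Finset.card_range k, ← Finset.prod_const, Finset.card_range]
  refine Finset.prod_le_prod (fun j _ => by positivity) fun j _ => ?_
  have h1 : x / (c + j) ≤ x / c := by gcongr; simp
  have h2 : 0 < 1 / c := by positivity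
  have h3 : x / c = 1 / c * x := by ring
  nlinarith

/-- Factor by factor, `1 + x ≤ (1 + c + j) (1 + x / (c + j))`. With `shiftFactor_le` this makes the
eigenvalue comparable to `(1 + x)^k`. -/
theorem pow_le_mul_shiftFactor {c : ℝ} (hc : 0 < c) (k : ℕ) {x : ℝ} (hx : 0 ≤ x) :
    (1 + x) ^ k ≤ (∏ j ∈ Finset.range k, (1 + c + j)) * shiftFactor c k x := by
  rw [shiftFactor, ← Finset.prod_mul_distrib]
  calc (1 + x) ^ k = ∏ _j ∈ Finset.range k, (1 + x) := by simp
    _ ≤ _ := Finset.prod_le_prod (fun _ _ => by positivity) fun j _ => by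
      have h1 : 0 < c + j := by positivity
      have h2 : (1 + c + j) * (1 + x / (c + j)) = 1 + x + ((c + j) + x / (c + j)) := by
        field_simp
        ring
      rw [h2]
      have : 0 ≤ x / (c + j) := by positivity
      linarith

theorem shiftFactor_eq_Gamma {c : ℝ} (hc : 0 < c) (k : ℕ) {x : ℝ} (hx : 0 ≤ x) :
    shiftFactor c k x =
      (Real.Gamma (c + k + x) / Real.Gamma (c + x)) * (Real.Gamma c / Real.Gamma (c + k)) := by
  induction k with
  | zero =>
    have h1 := (Real.Gamma_pos_of_pos hc).ne'
    have h2 := (Real.Gamma_pos_of_pos (by positivity : 0 < c + x)).ne'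
    simp [shiftFactor, h1, h2]
  | succ k ih =>
    have h1 : 0 < c + k := by positivity
    have h2 : 0 < c + k + x := by positivity
    have h3 := (Real.Gamma_pos_of_pos h1).ne'
    have h4 := (Real.Gamma_pos_of_pos (by positivity : 0 < c + x)).ne'
    rw [shiftFactor, Finset.prod_range_succ, ← shiftFactor, ih]
    push_cast
    rw [show c + (k + 1) + x = c + k + x + 1 by ring, ← add_assoc, Real.Gamma_add_one h2.ne',
      Real.Gamma_add_one h1.ne']
    field_simp

theorem shiftFactor_add (c : ℝ) (k l : ℕ) (x : ℝ) :
    shiftFactor c (k + l) x = shiftFactor c k x * shiftFactor (c + k) l x := by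
  simp only [shiftFactor, Finset.prod_range_add, Nat.cast_add, add_assoc]

/-- The factors of `B` and `A` join into `2n` consecutive ones starting at `lam`. Their Gamma
quotient cancels `Γ(lam + 2n)` and `Γ(lam + 2n + |m|)` in the weight. -/
theorem shiftFactor_mul_monomialWeight {d : ℕ} {lam : ℝ} (hlam : 0 < lam) (n : ℕ)
    (m : Fin d → ℕ) :
    shiftFactor (lam + n) n (∑ j, (m j : ℝ)) * shiftFactor lam n (∑ j, (m j : ℝ)) *
      monomialWeight (lam + 2 * n) m = monomialWeight lam m := by
  have hx : 0 ≤ ∑ j, (m j : ℝ) := by positivity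
  rw [mul_comm (shiftFactor _ _ _), ← shiftFactor_add, shiftFactor_eq_Gamma hlam _ hx,
    monomialWeight, monomialWeight]
  have h1 := (Real.Gamma_pos_of_pos (by positivity : 0 < lam + 2 * n)).ne'
  have h2 := (Real.Gamma_pos_of_pos (by positivity : 0 < lam + 2 * n + ∑ j, (m j : ℝ))).ne'
  have h3 := (Real.Gamma_pos_of_pos (by positivity : 0 < lam + ∑ j, (m j : ℝ))).ne'
  push_cast
  rw [← two_mul]
  field_simp

theorem HasMonomialExpansion.memBergman_numberOp_iff {d n : ℕ} {σ : ℝ} (hσ : (d : ℝ) < σ)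
    {f : unitBall d → ℂ} {a : (Fin d → ℕ) → ℂ} (h : HasMonomialExpansion f a) :
    (∀ k ≤ n, MemBergman σ (_root_.numberOp^[k] f)) ↔
      Summable fun m => (1 + ∑ j, (m j : ℝ)) ^ (2 * n) * (‖a m‖ ^ 2 * monomialWeight σ m) := by
  have hω (m : Fin d → ℕ) : 0 ≤ ‖a m‖ ^ 2 * monomialWeight σ m :=
    mul_nonneg (by positivity) (monomialWeight_pos (lt_of_le_of_lt d.cast_nonneg hσ) m).le
  have hk (k : ℕ) : MemBergman σ (_root_.numberOp^[k] f) ↔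
      Summable fun m => (∑ j, (m j : ℝ)) ^ (2 * k) * (‖a m‖ ^ 2 * monomialWeight σ m) := by
    rw [(h.numberOp_iterate k).memBergman_iff hσ]
    refine summable_congr fun m => ?_
    have h1 : (∑ j, (m j : ℂ)) = ((∑ j, (m j : ℝ) : ℝ) : ℂ) := by push_cast; rfl
    rw [h1, norm_mul, norm_pow, Complex.norm_real, Real.norm_of_nonneg (by positivity)]
    ring
  refine ⟨fun hN => ?_, fun hs k hkn => (hk k).2 (hs.of_nonneg_of_le
    (fun m => mul_nonneg (by positivity) (hω m)) fun m => ?_)⟩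
  · have h0 := (hk 0).1 (hN 0 n.zero_le)
    have h1 := (hk n).1 (hN n le_rfl)
    -- Only `k = 0` and `k = n` are needed: `(1 + x)^(2n) ≤ 2^(2n-1) (1 + x^(2n))`. For `n = 0` the
    -- exponent truncates to `0` and the bound reads `1 ≤ 2`.
    refine ((h0.add h1).mul_left (2 ^ (2 * n - 1))).of_nonneg_of_le
      (fun m => mul_nonneg (by positivity) (hω m)) fun m => ?_
    rw [mul_zero, pow_zero, ← add_mul, ← mul_assoc (2 ^ (2 * n - 1) : ℝ)]
    refine mul_le_mul_of_nonneg_right ?_ (hω m)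
    simpa using add_pow_le zero_le_one (by positivity : (0 : ℝ) ≤ ∑ j, (m j : ℝ)) (2 * n)
  · refine mul_le_mul_of_nonneg_right ?_ (hω m)
    have hx : 0 ≤ ∑ j, (m j : ℝ) := by positivity
    calc (∑ j, (m j : ℝ)) ^ (2 * k) ≤ (1 + ∑ j, (m j : ℝ)) ^ (2 * k) := by gcongr; linarith
      _ ≤ _ := pow_le_pow_right₀ (by linarith) (by omega)

/-- The ratio of the two weights is the product of the eigenvalues of `A` and `B`, comparable to `(1
+ |m|)^(2n)`. Thus the condition defining the space does not depend on `n`. -/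
theorem summable_pow_mul_monomialWeight_iff {d : ℕ} {lam : ℝ} (hlam : 0 < lam) (n : ℕ)
    (a : (Fin d → ℕ) → ℂ) :
    (Summable fun m => (1 + ∑ j, (m j : ℝ)) ^ (2 * n) *
      (‖a m‖ ^ 2 * monomialWeight (lam + 2 * n) m)) ↔
      Summable fun m => ‖a m‖ ^ 2 * monomialWeight lam m := by
  have hω (m : Fin d → ℕ) : 0 ≤ ‖a m‖ ^ 2 * monomialWeight (lam + 2 * n) m :=
    mul_nonneg (by positivity) (monomialWeight_pos (by positivity) m).le
  have hw (m : Fin d → ℕ) : 0 ≤ ‖a m‖ ^ 2 * monomialWeight lam m :=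
    mul_nonneg (by positivity) (monomialWeight_pos hlam m).le
  have hx (m : Fin d → ℕ) : 0 ≤ ∑ j, (m j : ℝ) := by positivity
  have hc : 0 < lam + n := by positivity
  have hfac (m : Fin d → ℕ) : ‖a m‖ ^ 2 * monomialWeight lam m =
      shiftFactor (lam + n) n (∑ j, (m j : ℝ)) * shiftFactor lam n (∑ j, (m j : ℝ)) *
        (‖a m‖ ^ 2 * monomialWeight (lam + 2 * n) m) := by
    rw [← shiftFactor_mul_monomialWeight hlam n m]
    ring
  refine ⟨fun h => (h.mul_left ((1 + 1 / (lam + n)) ^ n * (1 + 1 / lam) ^ n)).of_nonneg_of_le hw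
    fun m => ?_, fun h => (h.mul_left ((∏ j ∈ Finset.range n, (1 + (lam + n) + j)) *
      ∏ j ∈ Finset.range n, (1 + lam + j))).of_nonneg_of_le
      (fun m => mul_nonneg (by positivity) (hω m)) fun m => ?_⟩
  · rw [hfac, ← mul_assoc ((1 + 1 / (lam + n)) ^ n * (1 + 1 / lam) ^ n)]
    refine mul_le_mul_of_nonneg_right ?_ (hω m)
    refine (mul_le_mul (shiftFactor_le hc n (hx m)) (shiftFactor_le hlam n (hx m))
      (shiftFactor_pos hlam n (hx m)).le (by positivity)).trans_eq ?_
    rw [mul_pow, mul_pow, two_mul, pow_add]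
    ring
  · rw [hfac, ← mul_assoc ((∏ j ∈ Finset.range n, (1 + (lam + n) + j)) *
      ∏ j ∈ Finset.range n, (1 + lam + j))]
    refine mul_le_mul_of_nonneg_right ?_ (hω m)
    rw [two_mul, pow_add]
    refine (mul_le_mul (pow_le_mul_shiftFactor hc n (hx m)) (pow_le_mul_shiftFactor hlam n (hx m))
      (by positivity) ?_).trans_eq (by ring)
    exact (pow_nonneg (by positivity) n).trans (pow_le_mul_shiftFactor hc n (hx m))

theorem HasMonomialExpansion.memBergman_shiftProd {d n : ℕ} {σ c : ℝ} (hσ : (d : ℝ) < σ)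
    (hc : 0 < c) {f : unitBall d → ℂ} {a : (Fin d → ℕ) → ℂ} (h : HasMonomialExpansion f a)
    (hs : Summable fun m => (1 + ∑ j, (m j : ℝ)) ^ (2 * n) * (‖a m‖ ^ 2 * monomialWeight σ m)) :
    MemBergman σ (_root_.shiftProd c n f) := by
  have hω (m : Fin d → ℕ) : 0 ≤ ‖a m‖ ^ 2 * monomialWeight σ m :=
    mul_nonneg (by positivity) (monomialWeight_pos (lt_of_le_of_lt d.cast_nonneg hσ) m).le
  have hx (m : Fin d → ℕ) : 0 ≤ ∑ j, (m j : ℝ) := by positivity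
  have hpos (m : Fin d → ℕ) := shiftFactor_pos hc n (hx m)
  have heq (m : Fin d → ℕ) : ‖(shiftFactor c n (∑ j, (m j : ℝ)) : ℂ) * a m‖ ^ 2 *
      monomialWeight σ m = shiftFactor c n (∑ j, (m j : ℝ)) ^ 2 *
        (‖a m‖ ^ 2 * monomialWeight σ m) := by
    rw [norm_mul, Complex.norm_real, Real.norm_of_nonneg (hpos m).le]
    ring
  refine ((h.shiftProd c n).memBergman_iff hσ).2 ((hs.mul_left (((1 + 1 / c) ^ n) ^ 2)).of_nonneg_of_le
    (fun m => ?_) fun m => ?_)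
  · rw [heq]
    exact mul_nonneg (by positivity) (hω m)
  · rw [heq, ← mul_assoc (((1 + 1 / c) ^ n) ^ 2)]
    refine mul_le_mul_of_nonneg_right ?_ (hω m)
    refine (pow_le_pow_left₀ (hpos m).le (shiftFactor_le hc n (hx m)) 2).trans_eq ?_
    rw [mul_pow, mul_pow]
    ring

/-! ### Transport of a Hilbert space structure -/

/-- A form that pulls back to the inner product of `E` is itself an inner product, and `e` becomes
an isometry, which carries over completeness and density. -/
theorem exists_core_of_linearEquiv {E V : Type*} [NormedAddCommGroup E] [InnerProductSpace ℂ E]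
    [CompleteSpace E] [AddCommGroup V] [Module ℂ V] (e : E ≃ₗ[ℂ] V) (B : V → V → ℂ)
    (hB : ∀ x y, B (e x) (e y) = inner ℂ x y) :
    ∃ core : InnerProductSpace.Core ℂ V, (∀ f g, core.inner f g = B f g) ∧
      letI : NormedAddCommGroup V := core.toNormedAddCommGroup
      letI : InnerProductSpace ℂ V := InnerProductSpace.ofCore core.toCore
      CompleteSpace V ∧ (∀ f g : V, inner ℂ f g = B f g) ∧
        ∀ s : Set E, Dense (Submodule.span ℂ s : Set E) →
          Dense (Submodule.span ℂ (e '' s) : Set V) := by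
  have hB' (f g : V) : B f g = inner ℂ (e.symm f) (e.symm g) := by
    simpa using hB (e.symm f) (e.symm g)
  let core : InnerProductSpace.Core ℂ V :=
    { inner := B
      conj_inner_symm := fun f g => by
        change conj (B g f) = B f g
        rw [hB', hB', inner_conj_symm]
      re_inner_nonneg := fun f => by
        rw [hB']
        exact inner_self_nonneg
      add_left := fun f g h => by
        change B (f + g) h = B f h + B g h
        rw [hB', hB', hB', map_add, inner_add_left]
      smul_left := fun f g c => by
        change B (c • f) g = conj c * B f g
        rw [hB', hB', map_smul, inner_smul_left]
      definite := fun f hf => by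
        change B f f = 0 at hf
        rw [hB', inner_self_eq_zero] at hf
        simpa using hf }
  refine ⟨core, fun _ _ => rfl, ?_⟩
  let _ : NormedAddCommGroup V := core.toNormedAddCommGroup
  let _ : InnerProductSpace ℂ V := InnerProductSpace.ofCore core.toCore
  let E' : E ≃ₗᵢ[ℂ] V := e.isometryOfInner hB
  refine ⟨E'.symm.toIsometryEquiv.completeSpace, fun _ _ => rfl, fun s hs => ?_⟩
  have h := E'.surjective.denseRange.dense_image E'.continuous hs
  have himg : (Submodule.span ℂ (e '' s) : Set V) = E' '' (Submodule.span ℂ s : Set E) := by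
    change _ = e '' _
    rw [← LinearEquiv.coe_coe, Submodule.span_image, Submodule.map_coe]
  rw [himg]
  exact h

theorem GenBergman.ext {d n : ℕ} {lam : ℝ} {f g : GenBergman d lam n} (h : f.toFun = g.toFun) :
    f = g :=
  Subtype.ext h

theorem GenBergman.exists_expansion {d n : ℕ} {lam : ℝ} (hlam : 0 < lam)
    (hn : (d : ℝ) < lam + 2 * n) (f : GenBergman d lam n) :
    ∃ a, HasMonomialExpansion f.toFun a ∧ Summable fun m => ‖a m‖ ^ 2 * monomialWeight lam m := by
  obtain ⟨a, ha, -⟩ := (f.2.2 0 n.zero_le).exists_expansion hn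
  exact ⟨a, ha, (summable_pow_mul_monomialWeight_iff hlam n a).1
    ((ha.memBergman_numberOp_iff hn).1 f.2.2)⟩

theorem mem_genBergmanSubmodule {d n : ℕ} {lam : ℝ} (hlam : 0 < lam) (hn : (d : ℝ) < lam + 2 * n)
    {f : unitBall d → ℂ} {a : (Fin d → ℕ) → ℂ} (h : HasMonomialExpansion f a)
    (ha : Summable fun m => ‖a m‖ ^ 2 * monomialWeight lam m) : f ∈ genBergmanSubmodule d lam n :=
  ⟨h.holomorphic, (h.memBergman_numberOp_iff hn).2
    ((summable_pow_mul_monomialWeight_iff hlam n a).2 ha)⟩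

theorem HasMonomialExpansion.memBergman_opA_opB {d n : ℕ} {lam : ℝ} (hlam : 0 < lam)
    (hn : (d : ℝ) < lam + 2 * n) {f : unitBall d → ℂ} {a : (Fin d → ℕ) → ℂ}
    (h : HasMonomialExpansion f a) (ha : Summable fun m => ‖a m‖ ^ 2 * monomialWeight lam m) :
    MemBergman (lam + 2 * n) (opA lam n f) ∧ MemBergman (lam + 2 * n) (opB lam n f) := by
  have hs := (summable_pow_mul_monomialWeight_iff hlam n a).2 ha
  exact ⟨h.memBergman_shiftProd hn (by positivity) hs, h.memBergman_shiftProd hn hlam hs⟩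

theorem HasMonomialExpansion.hasSum_bergmanInner_opA_opB {d n : ℕ} {lam : ℝ} (hlam : 0 < lam)
    (hn : (d : ℝ) < lam + 2 * n) {f g : unitBall d → ℂ} {a b : (Fin d → ℕ) → ℂ}
    (hf : HasMonomialExpansion f a) (ha : Summable fun m => ‖a m‖ ^ 2 * monomialWeight lam m)
    (hg : HasMonomialExpansion g b) (hb : Summable fun m => ‖b m‖ ^ 2 * monomialWeight lam m) :
    HasSum (fun m => conj (a m) * b m * monomialWeight lam m)
      (bergmanInner (lam + 2 * n) (opA lam n f) (opB lam n g)) := by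
  refine ((hf.shiftProd (lam + n) n).hasHomogeneousExpansion.hasSum_bergmanInner hn
    (hg.shiftProd lam n).hasHomogeneousExpansion (hf.memBergman_opA_opB hlam hn ha).1.2
    (hg.memBergman_opA_opB hlam hn hb).2.2).of_eq (fun m => ?_) rfl
  rw [← shiftFactor_mul_monomialWeight hlam n m, map_mul, Complex.conj_ofReal]
  push_cast
  ring

/-! ### The `ℓ²` model of the space -/

/-- The Hilbert space of square-summable families indexed by the multi-indices. -/
abbrev MultiSeq (d : ℕ) : Type := lp (fun _ : Fin d → ℕ => ℂ) 2

theorem MultiSeq.summable_norm_sq {d : ℕ} (c : MultiSeq d) : Summable fun m => ‖c m‖ ^ 2 := by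
  simpa using (lp.memℓp c).summable (by simp)

/-- The coefficients of the power series with normalized coefficients `c`. -/
noncomputable def scaledCoeff {d : ℕ} (lam : ℝ) (c : MultiSeq d) (m : Fin d → ℕ) : ℂ :=
  c m / (√(monomialWeight lam m) : ℝ)

theorem norm_scaledCoeff_sq {d : ℕ} {lam : ℝ} (hlam : 0 < lam) (c : MultiSeq d)
    (m : Fin d → ℕ) : ‖scaledCoeff lam c m‖ ^ 2 * monomialWeight lam m = ‖c m‖ ^ 2 := by
  have hw := monomialWeight_pos hlam m
  rw [scaledCoeff, norm_div, Complex.norm_real, Real.norm_of_nonneg (Real.sqrt_nonneg _), div_pow,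
    Real.sq_sqrt hw.le, div_mul_cancel₀ _ hw.ne']

theorem summable_scaledCoeff {d : ℕ} {lam : ℝ} (hlam : 0 < lam) (c : MultiSeq d) :
    Summable fun m => ‖scaledCoeff lam c m‖ ^ 2 * monomialWeight lam m :=
  c.summable_norm_sq.congr fun m => (norm_scaledCoeff_sq hlam c m).symm

/-- The function with power series coefficients `scaledCoeff lam c`. -/
noncomputable def powerSeriesFun {d : ℕ} (lam : ℝ) (c : MultiSeq d) : unitBall d → ℂ :=
  fun z => ∑' m, scaledCoeff lam c m * monomialFun m z

theorem hasMonomialExpansion_powerSeriesFun {d : ℕ} {lam : ℝ} (hlam : 0 < lam) (c : MultiSeq d) :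
    HasMonomialExpansion (powerSeriesFun lam c) (scaledCoeff lam c) :=
  hasMonomialExpansion_tsum hlam (summable_scaledCoeff hlam c)

/-- The linear map from square-summable families to `GenBergman`. -/
noncomputable def powerSeriesMap {d n : ℕ} {lam : ℝ} (hlam : 0 < lam)
    (hn : (d : ℝ) < lam + 2 * n) : MultiSeq d →ₗ[ℂ] GenBergman d lam n where
  toFun c := (⟨powerSeriesFun lam c, mem_genBergmanSubmodule hlam hn
    (hasMonomialExpansion_powerSeriesFun hlam c) (summable_scaledCoeff hlam c)⟩ :
    genBergmanSubmodule d lam n)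
  map_add' c e := GenBergman.ext <| funext fun z =>
    (((hasMonomialExpansion_powerSeriesFun hlam c z).add
      (hasMonomialExpansion_powerSeriesFun hlam e z)).of_eq
      (fun m => by simp only [scaledCoeff, lp.coeFn_add, Pi.add_apply]; ring) rfl).tsum_eq
  map_smul' r c := GenBergman.ext <| funext fun z =>
    (((hasMonomialExpansion_powerSeriesFun hlam c z).mul_left r).of_eq
      (fun m => by simp only [scaledCoeff, lp.coeFn_smul, Pi.smul_apply, smul_eq_mul]; ring) rfl).tsum_eq

theorem toFun_powerSeriesMap {d n : ℕ} {lam : ℝ} (hlam : 0 < lam)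
    (hn : (d : ℝ) < lam + 2 * n) (c : MultiSeq d) :
    (powerSeriesMap hlam hn c).toFun = powerSeriesFun lam c := rfl

/-- Injectivity is uniqueness of coefficients. For surjectivity, the coefficients of `f` times `√w`
form a square-summable family. -/
theorem powerSeriesMap_bijective {d n : ℕ} {lam : ℝ} (hlam : 0 < lam)
    (hn : (d : ℝ) < lam + 2 * n) : Function.Bijective (powerSeriesMap hlam hn) := by
  have hw (m : Fin d → ℕ) : ((√(monomialWeight lam m) : ℝ) : ℂ) ≠ 0 := by
    exact_mod_cast (Real.sqrt_pos.2 (monomialWeight_pos hlam m)).ne'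
  refine ⟨fun c e hce => lp.ext (funext fun m => ?_), fun f => ?_⟩
  · have h1 := (hasMonomialExpansion_powerSeriesFun hlam c).hasHomogeneousExpansion
    have h2 := (hasMonomialExpansion_powerSeriesFun hlam e).hasHomogeneousExpansion
    rw [← toFun_powerSeriesMap hlam hn, hce, toFun_powerSeriesMap] at h1
    exact (div_left_inj' (hw m)).1 (congrFun (h1.unique h2) m)
  · obtain ⟨a, ha, hs⟩ := f.exists_expansion hlam hn
    let c : MultiSeq d := ⟨fun m => a m * (√(monomialWeight lam m) : ℝ), by
      refine memℓp_gen (hs.congr fun m => ?_)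
      have := (monomialWeight_pos hlam m).le
      simp [mul_pow, Real.sq_sqrt this]⟩
    have hc : scaledCoeff lam c = a := funext fun m => mul_div_cancel_right₀ _ (hw m)
    refine ⟨c, GenBergman.ext (funext fun z => ?_)⟩
    have := hasMonomialExpansion_powerSeriesFun hlam c z
    rw [hc] at this
    exact this.unique (ha z)

theorem bergmanInner_powerSeriesMap {d n : ℕ} {lam : ℝ} (hlam : 0 < lam)
    (hn : (d : ℝ) < lam + 2 * n) (c e : MultiSeq d) :
    bergmanInner (lam + 2 * n) (opA lam n (powerSeriesMap hlam hn c).toFun)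
      (opB lam n (powerSeriesMap hlam hn e).toFun) = inner ℂ c e := by
  refine ((hasMonomialExpansion_powerSeriesFun hlam c).hasSum_bergmanInner_opA_opB hlam hn
    (summable_scaledCoeff hlam c) (hasMonomialExpansion_powerSeriesFun hlam e)
    (summable_scaledCoeff hlam e)).unique ((lp.hasSum_inner c e).of_eq (fun m => ?_) rfl)
  have hw := monomialWeight_pos hlam m
  have h1 : ((√(monomialWeight lam m) : ℝ) : ℂ) ≠ 0 := by
    exact_mod_cast (Real.sqrt_pos.2 hw).ne'
  have h2 : (monomialWeight lam m : ℂ) = (√(monomialWeight lam m) : ℝ) * (√(monomialWeight lam m) : ℝ) := by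
    rw [← Complex.ofReal_mul, Real.mul_self_sqrt hw.le]
  rw [RCLike.inner_apply, scaledCoeff, scaledCoeff, map_div₀, Complex.conj_ofReal, h2]
  field_simp

/-- The family that represents the monomial `z^m`. -/
noncomputable def monomialSeq {d : ℕ} (lam : ℝ) (m : Fin d → ℕ) : MultiSeq d :=
  lp.single 2 m ((√(monomialWeight lam m) : ℝ) : ℂ)

theorem powerSeriesFun_monomialSeq {d : ℕ} {lam : ℝ} (hlam : 0 < lam) (m : Fin d → ℕ) :
    powerSeriesFun lam (monomialSeq lam m) = monomialFun m := by
  have hw : ((√(monomialWeight lam m) : ℝ) : ℂ) ≠ 0 := by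
    exact_mod_cast (Real.sqrt_pos.2 (monomialWeight_pos hlam m)).ne'
  funext z
  rw [powerSeriesFun, tsum_eq_single m fun l hl => by simp [scaledCoeff, monomialSeq, hl]]
  simp [scaledCoeff, monomialSeq, div_self hw]

theorem inner_monomialSeq {d : ℕ} {lam : ℝ} (hlam : 0 < lam) (l m : Fin d → ℕ) :
    inner ℂ (monomialSeq lam l) (monomialSeq lam m) =
      if l = m then (monomialWeight lam m : ℂ) else 0 := by
  rw [monomialSeq, lp.inner_single_left, RCLike.inner_apply, Complex.conj_ofReal]
  split_ifs with h
  · subst h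
    rw [monomialSeq, lp.single_apply_self, ← Complex.ofReal_mul,
      Real.mul_self_sqrt (monomialWeight_pos hlam l).le]
  · rw [monomialSeq, lp.single_apply_ne _ _ _ h, zero_mul]

theorem dense_span_monomialSeq {d : ℕ} {lam : ℝ} (hlam : 0 < lam) :
    Dense (Submodule.span ℂ (Set.range (monomialSeq (d := d) lam)) : Set (MultiSeq d)) := by
  intro c
  refine mem_closure_of_tendsto (lp.hasSum_single ENNReal.ofNat_ne_top c)
    (.of_forall fun s => Submodule.sum_mem _ fun m _ => ?_)
  have hw : ((√(monomialWeight lam m) : ℝ) : ℂ) ≠ 0 := by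
    exact_mod_cast (Real.sqrt_pos.2 (monomialWeight_pos hlam m)).ne'
  have h : lp.single (E := fun _ : Fin d → ℕ => ℂ) 2 m (c m) =
      (c m / (√(monomialWeight lam m) : ℝ)) • monomialSeq lam m := by
    rw [monomialSeq, ← lp.single_smul, smul_eq_mul, div_mul_cancel₀ _ hw]
  rw [h]
  exact Submodule.smul_mem _ _ (Submodule.subset_span ⟨m, rfl⟩)

/-- The family that represents evaluation at `z`. -/
noncomputable def kernelSeq {d : ℕ} {lam : ℝ} (hlam : 0 < lam) (z : unitBall d) : MultiSeq d :=
  ⟨fun m => conj (monomialFun m z) / (√(monomialWeight lam m) : ℝ), by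
    refine memℓp_gen ((summable_norm_monomialFun_sq_div hlam z).congr fun m => ?_)
    simp [div_pow, Real.sq_sqrt (monomialWeight_pos hlam m).le]⟩

/-- The factors `1 / √w` of both families combine so that the `ℓ²` inner product is, term by term,
the power series at `z`. -/
theorem inner_kernelSeq {d : ℕ} {lam : ℝ} (hlam : 0 < lam) (z : unitBall d) (c : MultiSeq d) :
    inner ℂ (kernelSeq hlam z) c = powerSeriesFun lam c z := by
  refine ((lp.hasSum_inner _ c).of_eq (fun m => ?_) rfl).unique
    (hasMonomialExpansion_powerSeriesFun hlam c z)
  simp only [RCLike.inner_apply, kernelSeq, scaledCoeff, map_div₀, Complex.conj_conj,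
    Complex.conj_ofReal]
  ring

theorem powerSeriesFun_kernelSeq {d : ℕ} {lam : ℝ} (hlam : 0 < lam) (z w : unitBall d) :
    powerSeriesFun lam (kernelSeq hlam z) w = conj (bergmanKernel lam z w) := by
  -- The bound `|z_j w_j| ≤ (|z_j|² + |w_j|²) / 2` puts the products `z_j w̄_j` in the region where
  -- the kernel series converges.
  have hx : ∑ j, ‖(z : Fin d → ℂ) j * conj ((w : Fin d → ℂ) j)‖ < 1 := by
    have hz : ∑ j, ‖(z : Fin d → ℂ) j‖ ^ 2 < 1 := z.2
    have hw : ∑ j, ‖(w : Fin d → ℂ) j‖ ^ 2 < 1 := w.2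
    have : ∑ j, ‖(z : Fin d → ℂ) j * conj ((w : Fin d → ℂ) j)‖ ≤
        ∑ j, (‖(z : Fin d → ℂ) j‖ ^ 2 + ‖(w : Fin d → ℂ) j‖ ^ 2) / 2 :=
      Finset.sum_le_sum fun j _ => by
        rw [norm_mul, RCLike.norm_conj]
        linarith [two_mul_le_add_sq ‖(z : Fin d → ℂ) j‖ ‖(w : Fin d → ℂ) j‖]
    rw [← Finset.sum_div, Finset.sum_add_distrib] at this
    linarith
  refine (hasMonomialExpansion_powerSeriesFun hlam (kernelSeq hlam z) w).unique
    ((Complex.hasSum_conj'.2 (hasSum_div_monomialWeight hlam hx)).of_eq (fun m => ?_) rfl)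
  have hw := monomialWeight_pos hlam m
  have h1 : ((√(monomialWeight lam m) : ℝ) : ℂ) ≠ 0 := by
    exact_mod_cast (Real.sqrt_pos.2 hw).ne'
  have h2 : (monomialWeight lam m : ℂ) = (√(monomialWeight lam m) : ℝ) * (√(monomialWeight lam m) : ℝ) := by
    rw [← Complex.ofReal_mul, Real.mul_self_sqrt hw.le]
  rw [map_mul, Complex.conj_ofReal, Complex.ofReal_inv, h2]
  simp only [scaledCoeff, kernelSeq, map_mul, map_prod, map_pow, Complex.conj_conj, mul_pow,
    Finset.prod_mul_distrib, monomialFun]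
  field_simp

/-! ### The theorem, read off from the `ℓ²` model -/

theorem mainTheorem1 (d n : ℕ) (lam : ℝ) (hlam : 0 < lam) (hn : (d : ℝ) < lam + 2 * n) :
    -- `A` and `B` map `H(𝔹ᵈ, lam)` into `HL²(𝔹ᵈ, μ_{lam + 2n})`
    (∀ f : GenBergman d lam n,
      MemBergman (lam + 2 * n) (opA lam n f.toFun) ∧
      MemBergman (lam + 2 * n) (opB lam n f.toFun)) ∧
    -- `⟨f, g⟩_lam = ⟨A f, B g⟩` is an inner product
    ∃ core : InnerProductSpace.Core ℂ (GenBergman d lam n),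
      (∀ f g : GenBergman d lam n,
        core.inner f g = bergmanInner (lam + 2 * n) (opA lam n f.toFun) (opB lam n g.toFun)) ∧
      letI : NormedAddCommGroup (GenBergman d lam n) := core.toNormedAddCommGroup
      letI : InnerProductSpace ℂ (GenBergman d lam n) := InnerProductSpace.ofCore core.toCore
      -- completeness
      CompleteSpace (GenBergman d lam n) ∧
      -- the monomials form an orthogonal basis
      (∃ e : (Fin d → ℕ) → GenBergman d lam n,
        (∀ m, (e m).toFun = monomialFun m) ∧
        (∀ l m, inner ℂ (e l) (e m) =
          if l = m then
            (((∏ j, ((m j).factorial : ℝ)) * Real.Gamma lam /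
              Real.Gamma (lam + ∑ j, (m j : ℝ)) : ℝ) : ℂ)
          else 0) ∧
        Dense (Submodule.span ℂ (Set.range e) : Set (GenBergman d lam n))) ∧
      -- the reproducing kernel
      (∀ z : unitBall d, ∃ χ : GenBergman d lam n,
        (∀ w : unitBall d, χ.toFun w = conj (bergmanKernel lam z w)) ∧
        ∀ f : GenBergman d lam n, inner ℂ χ f = f.toFun z) := by
  refine ⟨fun f => ?_, ?_⟩
  · obtain ⟨a, ha, hs⟩ := f.exists_expansion hlam hn
    exact ha.memBergman_opA_opB hlam hn hs
  let E := LinearEquiv.ofBijective (powerSeriesMap hlam hn) (powerSeriesMap_bijective hlam hn)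
  obtain ⟨core, hcore, hcomplete, hinner, hdense⟩ := exists_core_of_linearEquiv E
    (fun f g => bergmanInner (lam + 2 * n) (opA lam n f.toFun) (opB lam n g.toFun))
    (bergmanInner_powerSeriesMap hlam hn)
  refine ⟨core, hcore, hcomplete, ⟨fun m => E (monomialSeq lam m),
    powerSeriesFun_monomialSeq hlam, fun l m => ?_, ?_⟩, fun z => ⟨E (kernelSeq hlam z),
    powerSeriesFun_kernelSeq hlam z, fun f => ?_⟩⟩
  · exact (hinner _ _).trans ((bergmanInner_powerSeriesMap hlam hn _ _).trans
      (inner_monomialSeq hlam l m))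
  · have h := hdense _ (dense_span_monomialSeq hlam)
    rwa [← Set.range_comp] at h
  · obtain ⟨c, rfl⟩ := E.surjective f
    exact (hinner _ _).trans ((bergmanInner_powerSeriesMap hlam hn _ _).trans
      (inner_kernelSeq hlam z c))
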